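/- Let $G$ be a connected (finite-dimensional, real) Lie group with identity $e$ and Lie algebra $\mathfrak g=T_eG$, and let $\varphi=\{\varphi_t\}_{t\in\mathbb R}$ be a flow of automorphisms of $G$, that is, a (smooth) one-parameter group of automorphisms of $G$. The derivation $\mathcal D$ associated with $\varphi$ is determined by $(d\varphi_t)_e=\mathrm e^{t\mathcal D}$ for all $t\in\mathbb R$; the flow is called hyperbolic (resp. elliptic) if $\mathcal D$ is semisimple with only real (resp. purely imaginary) eigenvalues, and nilpotent if $\mathcal D$ is nilpotent. Let $$\varphi_t=\varphi^{\mathcal H}_t\circ\varphi^{\mathcal E}_t\circ\varphi^{\mathcal N}_t,\qquad t\in\mathbb R,$$ be the Jordan decomposition of $\varphi$ into commuting hyperbolic, elliptic and nilpotent flows of automorphisms, and let $\mathcal D_{\mathcal H}$ be the derivation associated with $\varphi^{\mathcal H}$. Put $G^0=\{g\in G:\varphi^{\mathcal H}_t(g)=g\ \text{for all }t\in\mathbb R\}$, and let $G^+$ and $G^-$ be the connected Lie subgroups of $G$ whose Lie algebras are the sums of the eigenspaces of $\mathcal D_{\mathcal H}$ for the positive and for the negative eigenvalues, respectively. The group $G$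 is called decomposable by $\varphi$ if $$G=(G^+G^0)G^-=(G^-G^0)G^+ .$$ For a topological group $H$ and a flow $\psi$ of automorphisms on $H$, a neighbourhood $U$ of the identity of $H$ and $\tau>0$, a $(U,\tau)$-chain from $x$ to $y$ consists of $n\ge 1$, points $x_0=x,x_1,\dots,x_n=y$ of $H$ and times $\tau_0,\dots,\tau_{n-1}\ge\tau$ such that $x_{i+1}^{-1}\psi_{\tau_i}(x_i)\in U$ for $i=0,\dots,n-1$. The chain recurrent set $\mathcal R_C(\psi)$ is the set of all $x\in H$ such that for every neighbourhood $U$ of the identity of $H$ and every $\tau>0$ there is a $(U,\tau)$-chain from $x$ to $x$. If $G$ is decomposable by $\varphi$, then $$\mathcal R_C(\varphi)=\mathcal R_C\left(\varphi|_{G^0}\right),$$ where $\varphi|_{G^0}$ is the restriction of $\varphi$ to the $\varphi$-invariant subgroup $G^0$, which carries the subspace topology. -/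

import Mathlib

open scoped Manifold ContDiff Pointwise Topology

noncomputable section

/-! ### Linear maps of the Lie algebra -/

section LinearMaps

variable {V : Type*} [AddCommGroup V] [Module ℝ V]

/-- Semisimple, and all complex eigenvalues are real. -/
def IsHyperbolicMap (D : Module.End ℝ V) : Prop :=
  D.IsSemisimple ∧
    ∀ z : ℂ, Module.End.HasEigenvalue (LinearMap.baseChange ℂ D) z → z.im = 0

/-- Semisimple, and all complex eigenvalues are purely imaginary (zero is allowed). -/
def IsEllipticMap (D : Module.End ℝ V) : Prop :=
  D.IsSemisimple ∧
    ∀ z : ℂ, Module.End.HasEigenvalue (LinearMap.baseChange ℂ D) z → z.re = 0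

/-- The sum of the eigenspaces of `D` for positive real eigenvalues. -/
def unstableSpace (D : Module.End ℝ V) : Submodule ℝ V :=
  ⨆ (l : ℝ) (_ : 0 < l), D.eigenspace l

/-- The sum of the eigenspaces of `D` for negative real eigenvalues. -/
def stableSpace (D : Module.End ℝ V) : Submodule ℝ V :=
  ⨆ (l : ℝ) (_ : l < 0), D.eigenspace l

end LinearMaps

/-! ### Chains -/

section Chains

variable {M : Type*} [Group M]

/-- `x 0, …, x n` and `t 0, …, t (n - 1)` form a `(U, τ)`-chain from `a` to `b` with `n ≥ 1` jumps
(the values of the sequences at larger indices play no role). -/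
structure IsJumpChain (φ : ℝ → M → M) (U : Set M) (τ : ℝ) (a b : M)
    (n : ℕ) (x : ℕ → M) (t : ℕ → ℝ) : Prop where
  pos : 1 ≤ n
  start : x 0 = a
  finish : x n = b
  time : ∀ i < n, τ ≤ t i
  jump : ∀ i < n, (x (i + 1))⁻¹ * φ (t i) (x i) ∈ U

/-- The points that can be reached from `a` by a `(U, τ)`-chain, for all neighbourhoods `U` of the
identity and all `τ > 0`. -/
def chainLimitSet [TopologicalSpace M] (φ : ℝ → M → M) (a : M) : Set M :=
  {b | ∀ U ∈ 𝓝 (1 : M), ∀ τ : ℝ, 0 < τ → ∃ n x t, IsJumpChain φ U τ a b n x t}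

/-- The chain recurrent set. -/
def chainRecurrentSet [TopologicalSpace M] (φ : ℝ → M → M) : Set M :=
  {a | a ∈ chainLimitSet φ a}

end Chains

/-! ### Flows of automorphisms of a Lie group -/

section Flows

variable (E : Type*) [NormedAddCommGroup E] [NormedSpace ℝ E]
  (G : Type*) [TopologicalSpace G] [ChartedSpace E G] [Group G]

/-- A flow of automorphisms of a Lie group `G` modelled on `E`: a smooth one-parameter group of
automorphisms. -/
structure AutFlow where
  toEquiv : ℝ → G ≃* G
  map_add : ∀ (s t : ℝ) (g : G), toEquiv (s + t) g = toEquiv s (toEquiv t g)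
  smooth : ContMDiff (𝓘(ℝ, ℝ).prod 𝓘(ℝ, E)) 𝓘(ℝ, E) ∞ (fun p : ℝ × G => toEquiv p.1 p.2)

variable {E G}

namespace AutFlow

instance : CoeFun (AutFlow E G) (fun _ => ℝ → G ≃* G) :=
  ⟨AutFlow.toEquiv⟩

/-- The flow all of whose maps are the identity. -/
def trivial : AutFlow E G where
  toEquiv _ := MulEquiv.refl G
  map_add _ _ _ := rfl
  smooth := contMDiff_snd

/-- The differential of `φ t` at the identity, as an endomorphism of the tangent space of `G` at
the identity, which is `E`. -/
def differential (φ : AutFlow E G) (t : ℝ) : E →L[ℝ] E :=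
  mfderiv 𝓘(ℝ, E) 𝓘(ℝ, E) (φ t) (1 : G)

/-- `D` is the derivation associated with `φ`: the differential of `φ t` at the identity is
`exp (t D)` for all `t`. -/
def HasDerivation (φ : AutFlow E G) (D : E →L[ℝ] E) : Prop :=
  ∀ t : ℝ, φ.differential t = NormedSpace.exp (t • D)

/-- The Jordan decomposition of a flow of automorphisms into commuting hyperbolic, elliptic and
nilpotent flows of automorphisms, together with their associated derivations. If `φ` has
derivation `D`, then `D = hypDer + ellDer + nilDer` is the additive Jordan decomposition of `D`. -/
structure JordanDecomposition (φ : AutFlow E G) where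
  (hyp ell nil : AutFlow E G)
  (hypDer ellDer nilDer : E →L[ℝ] E)
  hyp_der : hyp.HasDerivation hypDer
  ell_der : ell.HasDerivation ellDer
  nil_der : nil.HasDerivation nilDer
  hyp_hyperbolic : IsHyperbolicMap (hypDer : E →ₗ[ℝ] E)
  ell_elliptic : IsEllipticMap (ellDer : E →ₗ[ℝ] E)
  nil_nilpotent : IsNilpotent (nilDer : E →ₗ[ℝ] E)
  comm_hyp_ell : ∀ s t g, hyp s (ell t g) = ell t (hyp s g)
  comm_hyp_nil : ∀ s t g, hyp s (nil t g) = nil t (hyp s g)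
  comm_ell_nil : ∀ s t g, ell s (nil t g) = nil t (ell s g)
  eq_comp : ∀ t g, φ t g = hyp t (ell t (nil t g))

open Classical in
/-- The hyperbolic part of `φ`. On a connected Lie group every flow of automorphisms has exactly
one Jordan decomposition, so the second branch is never used there. -/
def hyperbolicPart (φ : AutFlow E G) : AutFlow E G :=
  if h : Nonempty φ.JordanDecomposition then h.some.hyp else trivial

open Classical in
/-- The derivation associated with the hyperbolic part of `φ`. -/
def hyperbolicDerivation (φ : AutFlow E G) : E →L[ℝ] E :=
  if h : Nonempty φ.JordanDecomposition then h.some.hypDer else 0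

/-- The central subgroup: the fixed points of the hyperbolic part. -/
def central (φ : AutFlow E G) : Subgroup G where
  carrier := {g | ∀ t, φ.hyperbolicPart t g = g}
  one_mem' t := map_one (φ.hyperbolicPart.toEquiv t)
  mul_mem' ha hb t := by rw [map_mul, ha t, hb t]
  inv_mem' ha t := by rw [map_inv, ha t]

end AutFlow

/-- The connected Lie subgroup of `G` that belongs to a subspace `𝔥` (a subalgebra) of the tangent
space at the identity: the subgroup generated by `exp 𝔥`, that is, by the values at time `1` of the
one-parameter subgroups of `G` whose initial velocity lies in `𝔥`. -/
def connectedSubgroup (𝔥 : Submodule ℝ E) : Subgroup G :=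
  Subgroup.closure {g : G | ∃ γ : ℝ → G,
    (∀ s t, γ (s + t) = γ s * γ t) ∧ ContMDiff 𝓘(ℝ, ℝ) 𝓘(ℝ, E) ∞ γ ∧
    (mfderiv 𝓘(ℝ, ℝ) 𝓘(ℝ, E) γ 0 (1 : ℝ) : E) ∈ 𝔥 ∧ γ 1 = g}

namespace AutFlow

/-- The unstable subgroup. -/
def unstable (φ : AutFlow E G) : Subgroup G :=
  connectedSubgroup (unstableSpace (φ.hyperbolicDerivation : E →ₗ[ℝ] E))

/-- The stable subgroup. -/
def stable (φ : AutFlow E G) : Subgroup G :=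
  connectedSubgroup (stableSpace (φ.hyperbolicDerivation : E →ₗ[ℝ] E))

/-- `G` is decomposable by `φ`: `G = (G⁺ G⁰) G⁻ = (G⁻ G⁰) G⁺`. -/
def Decomposes (φ : AutFlow E G) : Prop :=
  ((φ.unstable : Set G) * (φ.central : Set G)) * (φ.stable : Set G) = Set.univ ∧
    ((φ.stable : Set G) * (φ.central : Set G)) * (φ.unstable : Set G) = Set.univ

theorem hyperbolicPart_comm (φ : AutFlow E G) (s t : ℝ) (g : G) :
    φ.hyperbolicPart s (φ t g) = φ t (φ.hyperbolicPart s g) := by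
  unfold hyperbolicPart
  split_ifs with h
  · have hh : ∀ g, h.some.hyp s (h.some.hyp t g) = h.some.hyp t (h.some.hyp s g) := fun g => by
      rw [← h.some.hyp.map_add, ← h.some.hyp.map_add, add_comm]
    rw [h.some.eq_comp, h.some.eq_comp, hh, h.some.comm_hyp_ell, h.some.comm_hyp_nil]
  · rfl

theorem map_mem_central (φ : AutFlow E G) (t : ℝ) {g : G} (hg : g ∈ φ.central) :
    φ t g ∈ φ.central := fun s => by
  rw [hyperbolicPart_comm, hg s]

/-- The restriction of `φ` to the central subgroup. -/
def restrictCentral (φ : AutFlow E G) : ℝ → φ.central → φ.central :=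
  fun t g => ⟨φ t g, φ.map_mem_central t g.2⟩

end AutFlow

end Flows

end

/-! A chain in G⁰ is a chain in G, so only the inclusion of the left side in the right one needs an
argument. Let H be the hyperbolic flow and D its derivation. Replace G⁻ and G⁺ by dynamical groups:
let A be the group of points with H_t x → 1 as t → ∞ (`attracted`), C = G⁰A the group of points
whose orbit converges to a fixed point (`convergent`), and A', C' the same groups for reversed time.
Then G⁻ ≤ A and G⁺ ≤ A' (`connectedSubgroup_le_attracted`), so decomposability gives G = C'A = CA'.

Recurrence is handled by `ChainRecurrentIn.of_contracting`. If K = QP and the flow contracts P, each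
jump in K splits into a jump in Q and a small factor in P. A closed chain returns to the P-factor it
started with, which is therefore arbitrarily small, hence trivial, and the Q-factors form a closed
chain. This is applied to G = C'A and then, after time reversal, to C' = G⁰A'. The flow φ contracts
whatever H contracts, because the elliptic and nilpotent parts grow subexponentially.

It remains to see that elements near 1 have factors near 1. The tool is the velocity v(x) of x⁻¹ H_t
x at t = 0, a cocycle for the adjoint action with v(H_t x) = exp(tD) v(x) that vanishes exactly on
G⁰. Thanks to the decomposition, C is the preimage under v of the contracted subspace, hence closed,
and likewise C'. The open mapping theorem for C' × C acting on G yields small factors in G = C'C.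
Inside C = G⁰A, v ignores the G⁰-factor, and a small velocity forces a point of A to be small
(`AutFlow.exists_forall_velocity_lt_mem`). -/

noncomputable section

/-! ### Chains as transitive closures, and projection of recurrence along a contracted factor -/

section ChainRelations

open Relation Filter

variable {M : Type*} [Group M]

/-- One jump of a `(U, τ)`-chain between points of `K`. -/
def ChainStep (φ : ℝ → M → M) (K U : Set M) (τ : ℝ) (x y : M) : Prop :=
  x ∈ K ∧ y ∈ K ∧ ∃ t, τ ≤ t ∧ y⁻¹ * φ t x ∈ U

theorem exists_isJumpChain_iff (φ : ℝ → M → M) (U : Set M) (τ : ℝ) (a b : M) :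
    (∃ n x t, IsJumpChain φ U τ a b n x t) ↔ TransGen (ChainStep φ Set.univ U τ) a b := by
  constructor
  · rintro ⟨n, x, t, h⟩
    have key : ∀ m, m < n → TransGen (ChainStep φ Set.univ U τ) (x 0) (x (m + 1)) := by
      intro m
      induction m with
      | zero =>
        exact fun h0 => .single ⟨trivial, trivial, t 0, h.time 0 h0, h.jump 0 h0⟩
      | succ m ih =>
        exact fun hm => (ih (by omega)).tail
          ⟨trivial, trivial, t (m + 1), h.time _ hm, h.jump _ hm⟩
    have hn := h.pos
    have := key (n - 1) (by omega)
    rwa [h.start, Nat.sub_add_cancel hn, h.finish] at this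
  · intro h
    induction h with
    | single h =>
      rename_i b
      obtain ⟨-, -, t, ht, hj⟩ := h
      refine ⟨1, fun i => if i = 0 then a else b, fun _ => t, le_rfl, by simp, by simp,
        fun _ _ => ht, fun i hi => ?_⟩
      obtain rfl : i = 0 := by omega
      simpa using hj
    | tail _ h ih =>
      rename_i b c _
      obtain ⟨-, -, s, hs, hj⟩ := h
      obtain ⟨n, x, t, h⟩ := ih
      refine ⟨n + 1, fun i => if i ≤ n then x i else c, fun i => if i < n then t i else s,
        by omega, by simp [h.start], by simp, fun i hi => ?_, fun i hi => ?_⟩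
      · split_ifs with h1
        · exact h.time i h1
        · exact hs
      · rcases Nat.lt_succ_iff_lt_or_eq.mp hi with h1 | rfl
        · simpa [h1, h1.le, Nat.succ_le_iff] using h.jump i h1
        · simpa [h.finish] using hj

/-- A chain with arbitrary times can be refined to one with times in `[τ, 2τ]`. -/
theorem transGen_bounded_time {ψ : ℝ → M → M} (hadd : ∀ s t x, ψ (s + t) x = ψ s (ψ t x))
    {K : Set M} (hK : ∀ t, ∀ x ∈ K, ψ t x ∈ K) {U : Set M} (hU : 1 ∈ U) {τ : ℝ} (hτ : 0 < τ)
    {x y : M} (h : ChainStep ψ K U τ x y) :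
    TransGen (fun x y => x ∈ K ∧ y ∈ K ∧ ∃ t ∈ Set.Icc τ (2 * τ), y⁻¹ * ψ t x ∈ U) x y := by
  obtain ⟨hx, hy, t, ht, hj⟩ := h
  obtain ⟨n, hn⟩ := exists_nat_ge (t / τ)
  rw [div_le_iff₀ hτ] at hn
  induction n generalizing x t with
  | zero => norm_num at hn; linarith
  | succ n ih =>
    by_cases h2 : t ≤ 2 * τ
    · exact .single ⟨hx, hy, t, ⟨ht, h2⟩, hj⟩
    · refine TransGen.head (b := ψ τ x) ⟨hx, hK _ _ hx, τ, ⟨le_rfl, by linarith⟩, by simpa⟩ ?_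
      refine ih (hK _ _ hx) (t - τ) (by linarith) ?_ ?_
      · rwa [← hadd, sub_add_cancel]
      · push_cast at hn
        linarith

variable [TopologicalSpace M]

/-- `a` is chain recurrent, by chains that stay in `K`. -/
def ChainRecurrentIn (φ : ℝ → M → M) (K : Set M) (a : M) : Prop :=
  ∀ U ∈ 𝓝 (1 : M), ∀ τ : ℝ, 0 < τ → TransGen (ChainStep φ K U τ) a a

theorem mem_chainRecurrentSet_iff (φ : ℝ → M → M) (a : M) :
    a ∈ chainRecurrentSet φ ↔ ChainRecurrentIn φ Set.univ a := by
  simp only [chainRecurrentSet, chainLimitSet, Set.mem_ofPred_eq, exists_isJumpChain_iff]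
  rfl

theorem ChainRecurrentIn.mem {φ : ℝ → M → M} {K : Set M} {a : M}
    (h : ChainRecurrentIn φ K a) : a ∈ K := by
  obtain ⟨b, hb, -⟩ := (TransGen.head'_iff).1 (h Set.univ univ_mem 1 one_pos)
  exact hb.1

/-- Neighbourhoods of 1 in the subgroup are traces of neighbourhoods in `M`, so chains of the
restricted flow are chains of `M` that stay in `K`. Everything afterwards can take place in `M`. -/
theorem mem_image_chainRecurrentSet_iff {φ : ℝ → M → M} {K : Subgroup M} {ψ : ℝ → K → K}
    (hψ : ∀ t x, (ψ t x : M) = φ t x) (a : M) :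
    a ∈ Subtype.val '' chainRecurrentSet ψ ↔ ChainRecurrentIn φ K a := by
  constructor
  · rintro ⟨a, ha, rfl⟩ U hU τ hτ
    rw [mem_chainRecurrentSet_iff] at ha
    have hU' : Subtype.val ⁻¹' U ∈ 𝓝 (1 : K) :=
      continuous_subtype_val.continuousAt.preimage_mem_nhds (by simpa using hU)
    refine (ha _ hU' τ hτ).lift Subtype.val ?_
    rintro x y ⟨-, -, t, ht, hj⟩
    refine ⟨x.2, y.2, t, ht, ?_⟩
    simpa [hψ] using hj
  · intro h
    refine ⟨⟨a, h.mem⟩, ?_, rfl⟩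
    rw [mem_chainRecurrentSet_iff]
    intro U hU τ hτ
    obtain ⟨V, hV, hVU⟩ := mem_nhds_subtype (K : Set M) 1 U |>.1 hU
    have key : ∀ b, TransGen (ChainStep φ K V τ) a b →
        ∃ hb : b ∈ K, TransGen (ChainStep ψ Set.univ U τ) ⟨a, h.mem⟩ ⟨b, hb⟩ := by
      intro b hb
      induction hb with
      | single h =>
        obtain ⟨-, hb, t, ht, hj⟩ := h
        exact ⟨hb, .single ⟨trivial, trivial, t, ht, hVU (by simpa [hψ] using hj)⟩⟩
      | tail _ h ih =>
        obtain ⟨-, hb, t, ht, hj⟩ := h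
        obtain ⟨_, ih⟩ := ih
        exact ⟨hb, ih.tail ⟨trivial, trivial, t, ht, hVU (by simpa [hψ] using hj)⟩⟩
    exact (key a (h V (by simpa using hV) τ hτ)).2

variable [IsTopologicalGroup M]

/-- Chain recurrence is invariant under time reversal. -/
theorem ChainRecurrentIn.reverse {ψ : ℝ → M ≃* M}
    (hadd : ∀ s t x, ψ (s + t) x = ψ s (ψ t x)) (h0 : ∀ x, ψ 0 x = x)
    (hcont : Continuous fun p : ℝ × M => ψ p.1 p.2)
    {K : Set M} (hK : ∀ t, ∀ x ∈ K, ψ t x ∈ K) {a : M}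
    (h : ChainRecurrentIn (fun t => ψ t) K a) : ChainRecurrentIn (fun t => ψ (-t)) K a := by
  intro U hU τ hτ
  -- If u = y⁻¹ψ_t(x) is a jump, the reversed jump is x⁻¹ψ_{-t}(y) = ψ_{-t}(u⁻¹). Its smallness is
  -- uniform only for t in a compact set, which is why times are first cut down to [τ, 2τ].
  have hsmall : ∀ᶠ u in 𝓝 (1 : M), ∀ t ∈ Set.Icc τ (2 * τ), ψ (-t) u ∈ U := by
    refine isCompact_Icc.eventually_forall_of_forall_eventually fun t _ => ?_
    have hc : ContinuousAt (fun p : M × ℝ => ψ (-p.2) p.1) (1, t) :=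
      (hcont.comp (by fun_prop : Continuous fun p : M × ℝ => (-p.2, p.1))).continuousAt
    refine hc.eventually_mem ?_
    simpa using hU
  have hV : {u | ∀ t ∈ Set.Icc τ (2 * τ), ψ (-t) u⁻¹ ∈ U} ∈ 𝓝 (1 : M) := by
    have : Tendsto (fun u : M => u⁻¹) (𝓝 1) (𝓝 1) := by
      simpa using (continuous_inv (G := M)).tendsto 1
    exact this.eventually hsmall
  have hrefine := TransGen.lift' id (fun x y hxy => transGen_bounded_time
    (ψ := fun t => ψ t) hadd hK (mem_of_mem_nhds hV) hτ hxy) _ _ (h _ hV τ hτ)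
  rw [← transGen_swap]
  refine TransGen.mono ?_ _ _ hrefine
  rintro x y ⟨hx, hy, t, ht, hj⟩
  refine ⟨hy, hx, t, ht.1, ?_⟩
  have := hj t ht
  rw [mul_inv_rev, inv_inv, map_mul, map_inv, ← hadd, neg_add_cancel, h0] at this
  exact this

/-- Suppose that the group `K` is the product `Q P` of two invariant subgroups with trivial
intersection, that the factors of elements close to `1` are close to `1`, and that the flow
contracts `P` to `1`, uniformly on a neighbourhood of `1`. Then recurrence in `K` is recurrence
in `Q`. -/
theorem ChainRecurrentIn.of_contracting [T1Space M] {ψ : ℝ → M ≃* M} {K Q P : Subgroup M}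
    (hQK : Q ≤ K) (hQ : ∀ t, ∀ x ∈ Q, ψ t x ∈ Q)
    (hQP : ∀ g ∈ Q, g ∈ P → g = 1)
    (hprod : ∀ x ∈ K, ∃ q ∈ Q, ∃ p ∈ P, x = q * p)
    (hloc : ∀ U ∈ 𝓝 (1 : M), ∀ᶠ x in 𝓝 1, x ∈ K → ∃ q ∈ Q, q ∈ U ∧ ∃ p ∈ P, p ∈ U ∧ x = q * p)
    (hunif : ∃ V ∈ 𝓝 (1 : M), ∀ W ∈ 𝓝 (1 : M), ∀ᶠ t in atTop, ∀ p ∈ P, p ∈ V → ψ t p ∈ W)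
    (hpt : ∀ p ∈ P, Tendsto (fun t => ψ t p) atTop (𝓝 1))
    {a : M} (h : ChainRecurrentIn (fun t => ψ t) K a) :
    ChainRecurrentIn (fun t => ψ t) Q a := by
  obtain ⟨V, hV, hunif⟩ := hunif
  obtain ⟨q₀, hq₀, p₀, hp₀, rfl⟩ := hprod a h.mem
  have main : ∀ U ∈ 𝓝 (1 : M), ∀ τ : ℝ, 0 < τ →
      p₀ ∈ U ∧ TransGen (ChainStep (fun t => ψ t) Q U τ) q₀ q₀ := by
    intro U hU τ hτ
    have hUinv : {u : M | u⁻¹ ∈ U} ∈ 𝓝 (1 : M) :=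
      continuous_inv.continuousAt.preimage_mem_nhds (by simpa using hU)
    have hU₁ : U ∩ {u | u⁻¹ ∈ U} ∩ V ∈ 𝓝 (1 : M) := inter_mem (inter_mem hU hUinv) hV
    have hW := hloc _ hU₁
    have hmul : Tendsto (fun p : M × M => p.1 * p.2) (𝓝 1 ×ˢ 𝓝 1) (𝓝 1) := by
      simpa [nhds_prod_eq] using (continuous_mul (M := M)).tendsto (1, 1)
    obtain ⟨W', hW', U₀, hU₀, hWU⟩ := mem_prod_iff.1 (hmul.eventually hW)
    have hU₀inv : {u : M | u⁻¹ ∈ U₀} ∈ 𝓝 (1 : M) :=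
      continuous_inv.continuousAt.preimage_mem_nhds (by simpa using hU₀)
    obtain ⟨T, hT⟩ := eventually_atTop.1 ((hunif W' hW').and ((hpt p₀ hp₀).eventually_mem hW'))
    -- Only the initial factor p₀ may lie outside `V`; pointwise convergence takes care of it, and
    -- uniform contraction of all later factors.
    have step : ∀ q ∈ Q, ∀ p ∈ P, (p = p₀ ∨ p ∈ V) → ∀ y,
        ChainStep (fun t => ψ t) K {u | u⁻¹ ∈ U₀} (max τ T) (q * p) y →
        ∃ q' ∈ Q, ∃ p' ∈ P, p' ∈ U ∧ p' ∈ V ∧ y = q' * p' ∧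
          ChainStep (fun t => ψ t) Q U τ q q' := by
      rintro q hq p hp hpV y ⟨-, hy, t, ht, hj⟩
      have hψp : ψ t p ∈ W' := by
        rcases hpV with rfl | hpV
        · exact (hT t (le_of_max_le_right ht)).2
        · exact (hT t (le_of_max_le_right ht)).1 p hp hpV
      -- With u the jump, (ψ_t q)⁻¹ y = ψ_t(p) u⁻¹ is a product of two elements near 1 and lies in
      -- K, so `hloc` splits it into small factors q' and p'.
      have e : ψ t p * (y⁻¹ * ψ t (q * p))⁻¹ = (ψ t q)⁻¹ * y := by
        rw [map_mul]; group
      obtain ⟨q', hq', hqU, p', hp', hpU, heq⟩ := hWU (Set.mk_mem_prod hψp hj)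
        (by
          change ψ t p * (y⁻¹ * ψ t (q * p))⁻¹ ∈ K
          rw [e]
          exact K.mul_mem (K.inv_mem (hQK (hQ t q hq))) hy)
      change ψ t p * (y⁻¹ * ψ t (q * p))⁻¹ = q' * p' at heq
      rw [e] at heq
      refine ⟨ψ t q * q', Q.mul_mem (hQ t q hq) hq', p', hp', hpU.1.1, hpU.2, ?_, hq,
        Q.mul_mem (hQ t q hq) hq', t, le_of_max_le_left ht, ?_⟩
      · rw [mul_assoc, ← heq, mul_inv_cancel_left]
      · simpa using hqU.1.2
    have key : ∀ y, TransGen (ChainStep (fun t => ψ t) K {u | u⁻¹ ∈ U₀} (max τ T)) (q₀ * p₀) y →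
        ∃ q ∈ Q, ∃ p ∈ P, p ∈ U ∧ p ∈ V ∧ y = q * p ∧
          TransGen (ChainStep (fun t => ψ t) Q U τ) q₀ q := by
      intro y hy
      induction hy with
      | single h =>
        obtain ⟨q, hq, p, hp, hpU, hpV, e, hs⟩ := step q₀ hq₀ p₀ hp₀ (.inl rfl) _ h
        exact ⟨q, hq, p, hp, hpU, hpV, e, .single hs⟩
      | tail _ h ih =>
        obtain ⟨q, hq, p, hp, hpU, hpV, rfl, hs⟩ := ih
        obtain ⟨q', hq', p', hp', hpU', hpV', e, hs'⟩ := step q hq p hp (.inr hpV) _ h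
        exact ⟨q', hq', p', hp', hpU', hpV', e, hs.tail hs'⟩
    obtain ⟨q, hq, p, hp, hpU, -, e, hs⟩ := key _ (h _ hU₀inv (max τ T) (lt_max_of_lt_left hτ))
    -- Factorizations are unique since Q and P meet trivially: the chain returns to q₀, and p₀
    -- itself lies in U.
    have e1 : q⁻¹ * q₀ = p * p₀⁻¹ := by
      rw [inv_mul_eq_iff_eq_mul, ← mul_assoc, ← e, mul_inv_cancel_right]
    have e2 : q⁻¹ * q₀ = 1 := hQP _ (Q.mul_mem (Q.inv_mem hq) hq₀)
      (e1 ▸ P.mul_mem hp (P.inv_mem hp₀))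
    rw [e2] at e1
    obtain rfl : q = q₀ := inv_mul_eq_one.1 e2
    obtain rfl : p = p₀ := mul_inv_eq_one.1 e1.symm
    exact ⟨hpU, hs⟩
  have hp1 : p₀ = 1 := by
    by_contra hne
    exact (main {p₀}ᶜ (isOpen_compl_singleton.mem_nhds (Ne.symm hne)) 1 one_pos).1 rfl
  rw [hp1, mul_one]
  exact fun U hU τ hτ => (main U hU τ hτ).2

end ChainRelations

/-! ### Growth and decay of one-parameter groups of linear maps -/

section LinearFlows

open Filter NormedSpace

variable {E : Type*} [NormedAddCommGroup E] [NormedSpace ℝ E]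

/-- The vectors that the linear flow `exp (t D)` contracts to zero. -/
def contractingSpace (D : E →L[ℝ] E) : Submodule ℝ E where
  carrier := {w | Tendsto (fun t : ℝ => exp (t • D) w) atTop (𝓝 0)}
  zero_mem' := by simp
  add_mem' ha hb := by simpa using Tendsto.add ha hb
  smul_mem' c w hw := by simpa using Tendsto.const_smul hw c

theorem mem_contractingSpace {D : E →L[ℝ] E} {w : E} :
    w ∈ contractingSpace D ↔ Tendsto (fun t : ℝ => exp (t • D) w) atTop (𝓝 0) :=
  Iff.rfl

/-- The exponential series is a polynomial in t, and each |t|^k / k! is at most c^(-k) exp(c|t|). -/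
theorem exists_norm_exp_smul_le_of_isNilpotent {N : E →L[ℝ] E}
    (hN : IsNilpotent (N : E →ₗ[ℝ] E)) {c : ℝ} (hc : 0 < c) :
    ∃ C, ∀ t : ℝ, ‖exp (t • N)‖ ≤ C * Real.exp (c * |t|) := by
  obtain ⟨n, hn⟩ := hN
  have hn' : N ^ n = 0 := by
    ext v
    have := LinearMap.congr_fun hn v
    rwa [← ContinuousLinearMap.toLinearMap_pow] at this
  refine ⟨∑ k ∈ Finset.range n, ‖N ^ k‖ / c ^ k, fun t => ?_⟩
  rw [exp_eq_tsum ℝ]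
  have h0 : ∀ k ∉ Finset.range n, ((k.factorial : ℝ)⁻¹) • (t • N) ^ k = 0 := by
    intro k hk
    rw [smul_pow, pow_eq_zero_of_le (by simpa using hk) hn', smul_zero, smul_zero]
  change ‖∑' k : ℕ, ((k.factorial : ℝ)⁻¹) • (t • N) ^ k‖ ≤ _
  rw [tsum_eq_sum h0, Finset.sum_mul]
  refine norm_sum_le_of_le _ fun k _ => ?_
  have h1 := Real.pow_div_factorial_le_exp (c * |t|) (by positivity) k
  rw [smul_pow, norm_smul, norm_smul, norm_inv, norm_pow, Real.norm_eq_abs, Real.norm_eq_abs,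
    Nat.abs_cast]
  calc _ = ‖N ^ k‖ / c ^ k * ((c * |t|) ^ k / k.factorial) := by rw [mul_pow]; field_simp
    _ ≤ _ := by gcongr

variable [FiniteDimensional ℝ E]

theorem exp_add_smul (D : E →L[ℝ] E) (s t : ℝ) :
    exp ((s + t) • D) = exp (s • D) * exp (t • D) := by
  have := FiniteDimensional.complete ℝ E
  let _ : NormedAlgebra ℚ (E →L[ℝ] E) := NormedAlgebra.restrictScalars ℚ ℝ _
  rw [add_smul]
  exact exp_add_of_commute ((Commute.refl D).smul_left s |>.smul_right t)

theorem continuous_exp_smul (D : E →L[ℝ] E) : Continuous fun t : ℝ => exp (t • D) := by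
  have := FiniteDimensional.complete ℝ E
  exact continuous_iff_continuousAt.2 fun t => (hasDerivAt_exp_smul_const D t).continuousAt

theorem hasDerivAt_exp_smul_apply (D : E →L[ℝ] E) (w : E) (t : ℝ) :
    HasDerivAt (fun s : ℝ => exp (s • D) w) (exp (t • D) (D w)) t := by
  have := FiniteDimensional.complete ℝ E
  simpa using (hasDerivAt_exp_smul_const D t).clm_apply (hasDerivAt_const t w)

theorem exp_smul_mem_contractingSpace {D : E →L[ℝ] E} {w : E} (hw : w ∈ contractingSpace D)
    (s : ℝ) : exp (s • D) w ∈ contractingSpace D := by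
  have h : ∀ t : ℝ, exp (t • D) (exp (s • D) w) = exp ((t + s) • D) w := fun t => by
    rw [exp_add_smul, mul_apply_eq_comp]
  rw [mem_contractingSpace]
  simp only [h]
  exact hw.comp (tendsto_atTop_add_const_right _ s tendsto_id)

/-- In finite dimension, convergence to zero on a basis is convergence in operator norm. -/
theorem exists_norm_exp_smul_le_half (D : E →L[ℝ] E) :
    ∀ᶠ t in atTop, ∀ w ∈ contractingSpace D, ‖exp ((t : ℝ) • D) w‖ ≤ (1 / 2) * ‖w‖ := by
  obtain ⟨C, hC, hb⟩ := (Module.finBasis ℝ (contractingSpace D)).exists_opNorm_le (F := E)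
  have hsmall : ∀ᶠ t : ℝ in atTop, ∀ i,
      ‖exp (t • D) (Module.finBasis ℝ (contractingSpace D) i : E)‖ ≤ (2 * C)⁻¹ := by
    refine eventually_all.2 fun i => ?_
    have := mem_contractingSpace.1 (Module.finBasis ℝ (contractingSpace D) i).2
    have h0 : (0 : ℝ) < (2 * C)⁻¹ := by positivity
    filter_upwards [this.eventually (Metric.closedBall_mem_nhds 0 h0)] with t ht
    simpa using ht
  filter_upwards [hsmall] with t ht w hw
  have h1 := hb (u := (exp (t • D)).comp (contractingSpace D).subtypeL) (by positivity) ht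
  have h2 := ((exp (t • D)).comp (contractingSpace D).subtypeL).le_of_opNorm_le h1 ⟨w, hw⟩
  have h3 : C * (2 * C)⁻¹ = 1 / 2 := by field_simp
  rw [h3] at h2
  exact h2

/-- If time T halves all norms on the invariant contracted subspace, time nT divides them by 2^n;
the remainder of t modulo T costs a bounded factor. Hence the rate log 2 / T. -/
theorem exists_norm_exp_smul_le (D : E →L[ℝ] E) :
    ∃ c > 0, ∃ M > 0, ∀ w ∈ contractingSpace D, ∀ t : ℝ, 0 ≤ t →
      ‖exp (t • D) w‖ ≤ M * Real.exp (-(c * t)) * ‖w‖ := by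
  obtain ⟨T, hT, hT1⟩ := ((exists_norm_exp_smul_le_half D).and (eventually_ge_atTop 1)).exists
  have hT0 : 0 < T := by linarith
  obtain ⟨B, hB⟩ := (isCompact_Icc (a := (0 : ℝ)) (b := T)).exists_bound_of_continuousOn
    (continuous_exp_smul D).continuousOn
  have hiter : ∀ n : ℕ, ∀ w ∈ contractingSpace D, ‖exp ((n * T) • D) w‖ ≤ (1 / 2) ^ n * ‖w‖ := by
    intro n
    induction n with
    | zero => intro w _; simp
    | succ n ih =>
      intro w hw
      have e : ((n + 1 : ℕ) : ℝ) * T = n * T + T := by push_cast; ring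
      rw [e, exp_add_smul, mul_apply_eq_comp]
      refine (ih _ (exp_smul_mem_contractingSpace hw T)).trans ?_
      rw [pow_succ, mul_assoc]
      gcongr
      exact hT w hw
  refine ⟨Real.log 2 / T, by positivity, 2 * (|B| + 1), by positivity, fun w hw t ht => ?_⟩
  have hfl := Nat.floor_le (div_nonneg ht hT0.le)
  have hfl' := Nat.lt_floor_add_one (t / T)
  set n := ⌊t / T⌋₊
  rw [le_div_iff₀ hT0] at hfl
  have e : t = (t - n * T) + n * T := by ring
  have hs : t - n * T ∈ Set.Icc 0 T := by
    rw [div_lt_iff₀ hT0] at hfl'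
    constructor <;> linarith
  -- The factor 2 pays for rounding t/T down to n.
  have hpow : ((1 : ℝ) / 2) ^ n ≤ 2 * Real.exp (-(Real.log 2 / T * t)) := by
    have h2 : ((1 : ℝ) / 2) ^ n = Real.exp (-(Real.log 2 * n)) := by
      rw [Real.exp_neg, mul_comm, Real.exp_nat_mul, Real.exp_log two_pos]; simp
    have h3 : (2 : ℝ) = Real.exp (Real.log 2) := (Real.exp_log two_pos).symm
    rw [h2]
    nth_rewrite 2 [h3]
    rw [← Real.exp_add, Real.exp_le_exp]
    have : Real.log 2 / T * t = Real.log 2 * (t / T) := by ring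
    have hl : 0 < Real.log 2 := Real.log_pos one_lt_two
    rw [this]
    nlinarith
  calc ‖exp (t • D) w‖ = ‖exp ((t - n * T) • D) (exp ((n * T) • D) w)‖ := by
        rw [← mul_apply_eq_comp, ← exp_add_smul, ← e]
    _ ≤ ‖exp ((t - n * T) • D)‖ * ‖exp ((n * T) • D) w‖ := ContinuousLinearMap.le_opNorm _ _
    _ ≤ (|B| + 1) * ((2 * Real.exp (-(Real.log 2 / T * t))) * ‖w‖) := by
        gcongr
        · exact (hB _ hs).trans ((le_abs_self B).trans (by linarith))
        · exact (hiter n w hw).trans (by gcongr)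
    _ = _ := by ring

/-- For large t both exp(tD) and exp(-tD) halve norms on their contracted subspaces; composing them
gives ‖w‖ ≤ ‖w‖/4. -/
theorem eq_zero_of_mem_contractingSpace {D : E →L[ℝ] E} {w : E} (h : w ∈ contractingSpace D)
    (h' : w ∈ contractingSpace (-D)) : w = 0 := by
  obtain ⟨t, ht, ht'⟩ :=
    ((exists_norm_exp_smul_le_half D).and (exists_norm_exp_smul_le_half (-D))).exists
  have hmem : exp (t • D) w ∈ contractingSpace (-D) := by
    simpa using exp_smul_mem_contractingSpace h' (-t)
  have e : exp (t • -D) (exp (t • D) w) = w := by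
    rw [smul_neg, ← neg_smul, ← mul_apply_eq_comp, ← exp_add_smul]
    simp
  have h1 := ht' _ hmem
  have h2 := ht _ h
  rw [e] at h1
  have := norm_nonneg w
  exact norm_eq_zero.1 (by linarith)

theorem exp_smul_apply_of_mem_eigenspace {D : E →L[ℝ] E} {l : ℝ} {w : E}
    (hw : w ∈ Module.End.eigenspace (D : E →ₗ[ℝ] E) l) (t : ℝ) :
    exp (t • D) w = Real.exp (l * t) • w := by
  have hD : D w = l • w := Module.End.mem_eigenspace_iff.1 hw
  have key : ∀ s, HasDerivAt (fun s : ℝ => Real.exp (-(l * s)) • exp (s • D) w) 0 s := by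
    intro s
    have h1 : HasDerivAt (fun s : ℝ => Real.exp (-(l * s))) (Real.exp (-(l * s)) * -l) s := by
      simpa using ((hasDerivAt_id s).const_mul l).neg.exp
    refine (h1.smul (hasDerivAt_exp_smul_apply D w s)).congr_deriv ?_
    rw [hD, map_smul, smul_smul, ← add_smul]
    simp
  have hc := is_const_of_deriv_eq_zero (fun s => (key s).differentiableAt)
    (fun s => (key s).deriv) t 0
  simp only [mul_zero, neg_zero, Real.exp_zero, zero_smul, exp_zero, one_smul,
    one_apply_eq_self] at hc
  conv_rhs => rw [← hc]
  rw [smul_smul, ← Real.exp_add]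
  simp

theorem stableSpace_le_contractingSpace (D : E →L[ℝ] E) :
    stableSpace (D : E →ₗ[ℝ] E) ≤ contractingSpace D := by
  refine iSup₂_le fun l hl w hw => ?_
  rw [mem_contractingSpace]
  simp only [exp_smul_apply_of_mem_eigenspace hw]
  have : Tendsto (fun t : ℝ => Real.exp (l * t)) atTop (𝓝 0) :=
    Real.tendsto_exp_atBot.comp (tendsto_id.const_mul_atTop_of_neg hl)
  simpa using this.smul_const w

theorem unstableSpace_le_contractingSpace (D : E →L[ℝ] E) :
    unstableSpace (D : E →ₗ[ℝ] E) ≤ contractingSpace (-D) := by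
  refine iSup₂_le fun l hl w hw => ?_
  refine stableSpace_le_contractingSpace (-D)
    (Submodule.mem_iSup_of_mem (-l) (Submodule.mem_iSup_of_mem (neg_lt_zero.2 hl) ?_))
  rw [Module.End.mem_eigenspace_iff] at hw ⊢
  simpa using hw

/-- The minimal polynomial is squarefree, hence separable over ℝ; separability, unlike
squarefreeness in general, survives field extension. -/
theorem isSemisimple_baseChange_complex {D : Module.End ℝ E} (hD : D.IsSemisimple) :
    Module.End.IsSemisimple (LinearMap.baseChange ℂ D) := by
  refine Module.End.isSemisimple_of_squarefree_aeval_eq_zero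
    (p := (minpoly ℝ D).map (algebraMap ℝ ℂ)) ?_ ?_
  · exact ((PerfectField.separable_iff_squarefree.2 hD.minpoly_squarefree).map).squarefree
  · rw [Polynomial.aeval_map_algebraMap]
    change Polynomial.aeval (Module.End.baseChangeHom ℝ ℂ E D) (minpoly ℝ D) = 0
    rw [Polynomial.aeval_algHom_apply, minpoly.aeval, map_zero]

open TensorProduct in
-- After complexification the eigenvectors span, and on an eigenvector the function is a multiple of
-- exp(μt) with μ purely imaginary, so it has constant modulus.
theorem exists_norm_apply_exp_smul_le {D : E →L[ℝ] E} (hD : IsEllipticMap (D : E →ₗ[ℝ] E))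
    (ξ : E →L[ℝ] ℝ) (v : E) : ∃ C, ∀ t : ℝ, ‖ξ (exp (t • D) v)‖ ≤ C := by
  let L : ℂ ⊗[ℝ] E →ₗ[ℂ] ℂ :=
    (AlgebraTensorModule.rid ℝ ℂ ℂ).toLinearMap ∘ₗ LinearMap.baseChange ℂ (ξ : E →ₗ[ℝ] ℝ)
  let F : ℂ ⊗[ℝ] E → ℝ → ℂ := fun z t =>
    L (LinearMap.baseChange ℂ ((exp (t • D) : E →L[ℝ] E) : E →ₗ[ℝ] E) z)
  have hF : ∀ (a : ℂ) (w : E) (t : ℝ), F (a ⊗ₜ w) t = (ξ (exp (t • D) w)) • a :=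
    fun a w t => by simp [F, L]
  have hderiv : ∀ z t, HasDerivAt (F z) (F (LinearMap.baseChange ℂ (D : E →ₗ[ℝ] E) z) t) t := by
    intro z t
    induction z with
    | zero => simpa [F] using hasDerivAt_const t (0 : ℂ)
    | tmul a w =>
      rw [LinearMap.baseChange_tmul, hF, funext (hF a w)]
      exact ((ξ.hasFDerivAt.comp_hasDerivAt t (hasDerivAt_exp_smul_apply D w t))).smul_const a
    | add x y hx hy =>
      have e : ∀ x y : ℂ ⊗[ℝ] E, F (x + y) = F x + F y := fun x y => by
        funext s; simp [F]
      rw [map_add, e, e]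
      exact hx.add hy
  have hbdd : ∀ z, ∃ C, ∀ t, ‖F z t‖ ≤ C := by
    intro z
    have hz : z ∈ ⨆ μ : ℂ, Module.End.eigenspace (LinearMap.baseChange ℂ (D : E →ₗ[ℝ] E)) μ := by
      have h1 := Module.End.iSup_maxGenEigenspace_eq_top
        (LinearMap.baseChange ℂ (D : E →ₗ[ℝ] E))
      simp only [(isSemisimple_baseChange_complex
        hD.1).isFinitelySemisimple.maxGenEigenspace_eq_eigenspace] at h1
      rw [h1]
      trivial
    induction hz using Submodule.iSup_induction' with
    | mem μ z hz =>
      refine ⟨‖F z 0‖, fun t => ?_⟩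
      rcases eq_or_ne z 0 with rfl | hne
      · simp [F]
      have hre : μ.re = 0 := hD.2 μ (Module.End.hasEigenvalue_of_hasEigenvector ⟨hz, hne⟩)
      have hd : ∀ s, HasDerivAt (F z) (μ * F z s) s := fun s => by
        have := hderiv z s
        rwa [Module.End.mem_eigenspace_iff.1 hz, show F (μ • z) s = μ * F z s by simp [F]] at this
      have key : ∀ s : ℝ, HasDerivAt (fun s : ℝ => Complex.exp (-(μ * s)) * F z s) 0 s := by
        intro s
        have h1 : HasDerivAt (fun s : ℝ => Complex.exp (-(μ * s)))
            (Complex.exp (-(μ * s)) * -μ) s := by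
          simpa using ((Complex.ofRealCLM.hasDerivAt (x := s)).const_mul μ).neg.cexp
        refine (h1.mul (hd s)).congr_deriv ?_
        ring
      have hc := is_const_of_deriv_eq_zero (fun s => (key s).differentiableAt)
        (fun s => (key s).deriv) t 0
      have hn := congrArg norm hc
      simp only [norm_mul, Complex.norm_exp] at hn
      simp [hre] at hn
      exact hn.le
    | zero => exact ⟨0, fun t => by simp [F]⟩
    | add x y _ _ hx hy =>
      obtain ⟨A, hA⟩ := hx
      obtain ⟨B, hB⟩ := hy
      refine ⟨A + B, fun t => ?_⟩
      rw [show F (x + y) t = F x t + F y t by simp [F]]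
      exact norm_add_le_of_le (hA t) (hB t)
  obtain ⟨C, hC⟩ := hbdd (1 ⊗ₜ v)
  refine ⟨C, fun t => ?_⟩
  have := hC t
  rw [hF] at this
  simpa using this

theorem exists_norm_exp_smul_le_of_isEllipticMap {D : E →L[ℝ] E}
    (hD : IsEllipticMap (D : E →ₗ[ℝ] E)) : ∃ C, ∀ t : ℝ, ‖exp (t • D)‖ ≤ C := by
  have := FiniteDimensional.complete ℝ E
  refine banach_steinhaus fun v => ?_
  let e := (Module.finBasis ℝ E).equivFunL
  choose C hC using fun i => exists_norm_apply_exp_smul_le hD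
    ((ContinuousLinearMap.proj (R := ℝ) (φ := fun _ => ℝ) i).comp
      (e : E →L[ℝ] (Fin (Module.finrank ℝ E) → ℝ))) v
  refine ⟨‖(e.symm : (Fin (Module.finrank ℝ E) → ℝ) →L[ℝ] E)‖ * ∑ i, |C i|, fun t => ?_⟩
  have h1 : exp (t • D) v =
      (e.symm : (Fin (Module.finrank ℝ E) → ℝ) →L[ℝ] E) (e (exp (t • D) v)) := by simp
  rw [h1]
  refine ((e.symm : (Fin (Module.finrank ℝ E) → ℝ) →L[ℝ] E).le_opNorm _).trans ?_
  gcongr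
  refine (pi_norm_le_iff_of_nonneg (by positivity)).2 fun i => ?_
  exact ((hC i t).trans (le_abs_self _)).trans
    (Finset.single_le_sum (f := fun i => |C i|) (fun _ _ => abs_nonneg _) (Finset.mem_univ i))

/-- The growth of the elliptic and the nilpotent factors is subexponential. -/
theorem exists_norm_exp_mul_exp_le {A N : E →L[ℝ] E} (hA : IsEllipticMap (A : E →ₗ[ℝ] E))
    (hN : IsNilpotent (N : E →ₗ[ℝ] E)) {c : ℝ} (hc : 0 < c) :
    ∃ C, ∀ t : ℝ, ‖exp (t • A) * exp (t • N)‖ ≤ C * Real.exp (c * |t|) := by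
  obtain ⟨B, hB⟩ := exists_norm_exp_smul_le_of_isEllipticMap hA
  obtain ⟨C, hC⟩ := exists_norm_exp_smul_le_of_isNilpotent hN hc
  refine ⟨B * C, fun t => (norm_mul_le _ _).trans ?_⟩
  rw [mul_assoc]
  exact mul_le_mul (hB t) (hC t) (norm_nonneg _) ((norm_nonneg _).trans (hB t))

end LinearFlows

/-! ### Differential calculus in the chart at the identity -/

section ChartAtOne

open Filter

variable {E : Type*} [NormedAddCommGroup E] [NormedSpace ℝ E]
  {G : Type*} [TopologicalSpace G] [ChartedSpace E G] [Group G]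

variable (E G) in
/-- The preferred chart at the identity. -/
abbrev oneChart : PartialEquiv G E := extChartAt 𝓘(ℝ, E) (1 : G)

/-- The derivative at the identity, in the preferred chart, of a self-map of `G`. -/
def coordDeriv (Ψ : G → G) : E →L[ℝ] E :=
  fderiv ℝ (fun w => oneChart E G (Ψ ((oneChart E G).symm w))) (oneChart E G 1)

theorem oneChart_source_mem_nhds : (oneChart E G).source ∈ 𝓝 (1 : G) :=
  extChartAt_source_mem_nhds 1

theorem oneChart_symm_one : (oneChart E G).symm (oneChart E G 1) = 1 :=
  extChartAt_to_inv 1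

theorem coordDeriv_id (v : E) : coordDeriv (fun g : G => g) v = v := by
  have h : HasFDerivAt (fun w => oneChart E G ((oneChart E G).symm w)) (.id ℝ E)
      (oneChart E G 1) := by
    refine (hasFDerivAt_id _).congr_of_eventuallyEq ?_
    filter_upwards [extChartAt_target_mem_nhds (I := 𝓘(ℝ, E)) (1 : G)] with w hw
    simp only [id, (oneChart E G).right_inv hw]
  rw [coordDeriv, h.fderiv, ContinuousLinearMap.id_apply]

theorem mfderiv_one_eq_coordDeriv {Ψ : G → G} (hΨ : ContMDiffAt 𝓘(ℝ, E) 𝓘(ℝ, E) ∞ Ψ 1)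
    (h1 : Ψ 1 = 1) : (mfderiv 𝓘(ℝ, E) 𝓘(ℝ, E) Ψ 1 : E →L[ℝ] E) = coordDeriv (E := E) Ψ := by
  have h : @Eq (E →L[ℝ] E) (mfderiv 𝓘(ℝ, E) 𝓘(ℝ, E) Ψ 1)
      (fderivWithin ℝ (writtenInExtChartAt 𝓘(ℝ, E) 𝓘(ℝ, E) 1 Ψ) (Set.range 𝓘(ℝ, E))
        (oneChart E G 1)) := (hΨ.mdifferentiableAt (by simp)).mfderiv
  have h2 : writtenInExtChartAt 𝓘(ℝ, E) 𝓘(ℝ, E) 1 Ψ =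
      fun w => oneChart E G (Ψ ((oneChart E G).symm w)) := by
    unfold writtenInExtChartAt
    rw [h1]
    rfl
  refine h.trans ?_
  rw [h2, modelWithCornersSelf_coe, Set.range_id, fderivWithin_univ]
  rfl

variable [LieGroup 𝓘(ℝ, E) ∞ G]

theorem contMDiffAt_oneChart {g : G} (hg : g ∈ (oneChart E G).source) :
    ContMDiffAt 𝓘(ℝ, E) 𝓘(ℝ, E) ∞ (oneChart E G) g :=
  contMDiffAt_extChartAt' (by simpa [oneChart] using hg)

theorem contMDiffAt_extChartAt_symm (x : G) :
    ContMDiffAt 𝓘(ℝ, E) 𝓘(ℝ, E) ∞ (extChartAt 𝓘(ℝ, E) x).symm (extChartAt 𝓘(ℝ, E) x x) :=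
  (contMDiffOn_extChartAt_symm x).contMDiffAt (extChartAt_target_mem_nhds x)

/-- Derivatives in the chart at the identity depend continuously on a parameter. -/
theorem continuousAt_fderiv_oneChart {F : Type*} [NormedAddCommGroup F] [NormedSpace ℝ F]
    {Ψ : G → F → G} {x₀ : G} {w₀ : F}
    (h : ContMDiffAt (𝓘(ℝ, E).prod 𝓘(ℝ, F)) 𝓘(ℝ, E) ∞ (fun p : G × F => Ψ p.1 p.2) (x₀, w₀))
    (hs : Ψ x₀ w₀ ∈ (oneChart E G).source) :
    ContinuousAt (fun x => fderiv ℝ (fun w => oneChart E G (Ψ x w)) w₀) x₀ := by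
  set χ := extChartAt 𝓘(ℝ, E) x₀ with hχ
  -- A chart around x₀ makes the parameter a vector too; the derivative in question is then a
  -- partial derivative of the smooth map Φ.
  let Φ : E × F → E := fun p => oneChart E G (Ψ (χ.symm p.1) p.2)
  have hχ0 : χ.symm (χ x₀) = x₀ := extChartAt_to_inv x₀
  have hΦ : ContDiffAt ℝ ∞ Φ (χ x₀, w₀) := by
    rw [← contMDiffAt_iff_contDiffAt]
    have h1 := ((contMDiffAt_extChartAt_symm x₀).comp (χ x₀, w₀)
      (contDiffAt_fst.contMDiffAt)).prodMk (contDiffAt_snd (p := (χ x₀, w₀))).contMDiffAt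
    have h2 : ContMDiffAt (𝓘(ℝ, E).prod 𝓘(ℝ, F)) 𝓘(ℝ, E) ∞
        (fun p : G × F => oneChart E G (Ψ p.1 p.2)) (χ.symm (χ x₀), w₀) := by
      rw [hχ0]
      exact (contMDiffAt_oneChart hs).comp (x₀, w₀) h
    exact ContMDiffAt.comp (g := fun p : G × F => oneChart E G (Ψ p.1 p.2))
      (f := fun p : E × F => (χ.symm p.1, p.2)) (χ x₀, w₀) h2 h1
  have hcont : ContinuousAt (fun x => (fderiv ℝ Φ (χ x, w₀)).comp (.inr ℝ E F)) x₀ := by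
    have h1 : ContinuousAt (fun x => (χ x, w₀)) x₀ :=
      (continuousAt_extChartAt x₀).prodMk continuousAt_const
    have h2 : ContinuousAt (fderiv ℝ Φ) (χ x₀, w₀) :=
      (hΦ.fderiv_right (m := 0) (by simp)).continuousAt
    exact ((ContinuousAt.comp (f := fun x => (χ x, w₀)) h2 h1)).clm_comp continuousAt_const
  refine hcont.congr ?_
  have hdiff : ∀ᶠ p in 𝓝 (χ x₀, w₀), DifferentiableAt ℝ Φ p :=
    ((hΦ.of_le (m := 1) (by simp)).eventually (by simp)).mono
      fun p hp => hp.differentiableAt (by simp)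
  have h1 : ContinuousAt (fun x => (χ x, w₀)) x₀ :=
    (continuousAt_extChartAt x₀).prodMk continuousAt_const
  filter_upwards [h1.eventually hdiff, extChartAt_source_mem_nhds (I := 𝓘(ℝ, E)) x₀]
    with x hx hxs
  have e : (fun w => oneChart E G (Ψ x w)) = Φ ∘ fun w => (χ x, w) := by
    funext w
    simp only [Φ, Function.comp, χ.left_inv hxs]
  rw [e]
  exact (hx.hasFDerivAt.comp w₀ (hasFDerivAt_prodMk_right (χ x) w₀)).fderiv.symm

theorem differentiableAt_oneChart_comp {Ψ : G → G} (hΨ : ContMDiffAt 𝓘(ℝ, E) 𝓘(ℝ, E) ∞ Ψ 1)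
    (hs : Ψ 1 ∈ (oneChart E G).source) :
    DifferentiableAt ℝ (fun w => oneChart E G (Ψ ((oneChart E G).symm w))) (oneChart E G 1) := by
  have h : ContMDiffAt 𝓘(ℝ, E) 𝓘(ℝ, E) ∞ (fun g => oneChart E G (Ψ g))
      ((oneChart E G).symm (oneChart E G 1)) := by
    rw [oneChart_symm_one]
    exact (contMDiffAt_oneChart hs).comp 1 hΨ
  have h2 := h.comp (oneChart E G 1) (contMDiffAt_extChartAt_symm (1 : G))
  exact (contMDiffAt_iff_contDiffAt.1 h2).differentiableAt (by simp)

theorem hasDerivAt_oneChart_comp {Ψ : G → G} (hΨ : ContMDiffAt 𝓘(ℝ, E) 𝓘(ℝ, E) ∞ Ψ 1)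
    (hs : Ψ 1 ∈ (oneChart E G).source) {c : ℝ → G} {t : ℝ} {v : E} (hc : ContinuousAt c t)
    (h1 : c t = 1) (hv : HasDerivAt (fun s => oneChart E G (c s)) v t) :
    HasDerivAt (fun s => oneChart E G (Ψ (c s))) (coordDeriv Ψ v) t := by
  have h2 := (differentiableAt_oneChart_comp hΨ hs).hasFDerivAt
  rw [← h1] at h2
  have h3 := h2.comp_hasDerivAt t hv
  rw [h1] at h3
  refine h3.congr_of_eventuallyEq ?_
  have h4 : ∀ᶠ s in 𝓝 t, c s ∈ (oneChart E G).source :=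
    hc.eventually_mem (by rw [h1]; exact oneChart_source_mem_nhds)
  filter_upwards [h4] with s hs
  simp only [Function.comp, (oneChart E G).left_inv hs]

theorem coordDeriv_comp {Ψ Φ : G → G} (hΨ : ContMDiffAt 𝓘(ℝ, E) 𝓘(ℝ, E) ∞ Ψ 1)
    (hΦ : ContMDiffAt 𝓘(ℝ, E) 𝓘(ℝ, E) ∞ Φ 1) (hs : Ψ 1 ∈ (oneChart E G).source) (h1 : Φ 1 = 1)
    (v : E) : coordDeriv (fun g => Ψ (Φ g)) v = coordDeriv Ψ (coordDeriv Φ v) := by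
  have hΦs : Φ 1 ∈ (oneChart E G).source := by rw [h1]; exact mem_extChartAt_source 1
  have hf := (differentiableAt_oneChart_comp hΦ hΦs).hasFDerivAt
  have hg := (differentiableAt_oneChart_comp hΨ hs).hasFDerivAt
  have e : oneChart E G (Φ ((oneChart E G).symm (oneChart E G 1))) = oneChart E G 1 := by
    rw [oneChart_symm_one, h1]
  rw [← e] at hg
  have h2 := HasFDerivAt.comp (f := fun w => oneChart E G (Φ ((oneChart E G).symm w)))
    (oneChart E G 1) hg hf
  rw [e] at h2
  have h3 : HasFDerivAt (fun w => oneChart E G (Ψ (Φ ((oneChart E G).symm w))))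
      ((coordDeriv Ψ).comp (coordDeriv Φ)) (oneChart E G 1) := by
    refine h2.congr_of_eventuallyEq ?_
    have hc : ContinuousAt (fun w => Φ ((oneChart E G).symm w)) (oneChart E G 1) := by
      refine ContinuousAt.comp (g := Φ) ?_ (contMDiffAt_extChartAt_symm (1 : G)).continuousAt
      rw [oneChart_symm_one]
      exact hΦ.continuousAt
    have h4 : ∀ᶠ w in 𝓝 (oneChart E G 1), Φ ((oneChart E G).symm w) ∈ (oneChart E G).source := by
      refine hc.eventually_mem ?_
      rw [oneChart_symm_one, h1]
      exact oneChart_source_mem_nhds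
    filter_upwards [h4] with w hw
    simp only [Function.comp, (oneChart E G).left_inv hw]
  rw [coordDeriv, h3.fderiv, ContinuousLinearMap.comp_apply]

/-- The derivative of multiplication at (1, 1) is addition, as it is the identity on each factor. -/
theorem hasDerivAt_oneChart_mul {c d : ℝ → G} {t : ℝ} {v w : E} (hc : ContinuousAt c t)
    (hd : ContinuousAt d t) (hc1 : c t = 1) (hd1 : d t = 1)
    (hv : HasDerivAt (fun s => oneChart E G (c s)) v t)
    (hw : HasDerivAt (fun s => oneChart E G (d s)) w t) :
    HasDerivAt (fun s => oneChart E G (c s * d s)) (v + w) t := by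
  set o := oneChart E G 1 with ho
  let m : E × E → E := fun p =>
    oneChart E G ((oneChart E G).symm p.1 * (oneChart E G).symm p.2)
  have hsymm : (oneChart E G).symm o = 1 := oneChart_symm_one
  have hm : ContDiffAt ℝ ∞ m (o, o) := by
    rw [← contMDiffAt_iff_contDiffAt]
    have h1 := ((contMDiffAt_extChartAt_symm (1 : G)).comp (o, o)
      (contDiffAt_fst.contMDiffAt)).mul ((contMDiffAt_extChartAt_symm (1 : G)).comp (o, o)
      (contDiffAt_snd.contMDiffAt))
    refine ContMDiffAt.comp (o, o) (contMDiffAt_oneChart ?_) h1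
    change (oneChart E G).symm o * (oneChart E G).symm o ∈ _
    rw [hsymm, mul_one]
    exact mem_extChartAt_source 1
  have hm' := (hm.differentiableAt (by simp)).hasFDerivAt
  have htarget : ∀ᶠ z in 𝓝 o, z ∈ (oneChart E G).target := extChartAt_target_mem_nhds (1 : G)
  have hinl : ∀ v, fderiv ℝ m (o, o) (v, 0) = v := by
    intro v
    have h1 := (HasFDerivAt.comp (f := fun z => (z, o)) o hm' (hasFDerivAt_prodMk_left o o)).unique
      ((hasFDerivAt_id o).congr_of_eventuallyEq (by
        filter_upwards [htarget] with z hz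
        simp only [m, Function.comp, hsymm, mul_one, (oneChart E G).right_inv hz, id]))
    simpa using DFunLike.congr_fun h1 v
  have hinr : ∀ v, fderiv ℝ m (o, o) (0, v) = v := by
    intro v
    have h1 := (HasFDerivAt.comp (f := fun z => (o, z)) o hm' (hasFDerivAt_prodMk_right o o)).unique
      ((hasFDerivAt_id o).congr_of_eventuallyEq (by
        filter_upwards [htarget] with z hz
        simp only [m, Function.comp, hsymm, one_mul, (oneChart E G).right_inv hz, id]))
    simpa using DFunLike.congr_fun h1 v
  have hpt : (oneChart E G (c t), oneChart E G (d t)) = (o, o) := by rw [hc1, hd1]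
  rw [← hpt] at hm'
  have h2 := hm'.comp_hasDerivAt t (hv.prodMk hw)
  rw [hpt, show ((v, w) : E × E) = (v, 0) + (0, w) by simp, map_add, hinl, hinr] at h2
  refine h2.congr_of_eventuallyEq ?_
  have hc4 : ∀ᶠ s in 𝓝 t, c s ∈ (oneChart E G).source :=
    hc.eventually_mem (by rw [hc1]; exact oneChart_source_mem_nhds)
  have hd4 : ∀ᶠ s in 𝓝 t, d s ∈ (oneChart E G).source :=
    hd.eventually_mem (by rw [hd1]; exact oneChart_source_mem_nhds)
  filter_upwards [hc4, hd4] with s hs hs'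
  simp only [m, Function.comp, (oneChart E G).left_inv hs, (oneChart E G).left_inv hs']

theorem hasDerivAt_oneChart_of_mfderiv {c : ℝ → G} (hc : ContMDiff 𝓘(ℝ, ℝ) 𝓘(ℝ, E) ∞ c)
    (h1 : c 0 = 1) :
    HasDerivAt (fun s => oneChart E G (c s)) (mfderiv 𝓘(ℝ, ℝ) 𝓘(ℝ, E) c 0 (1 : ℝ) : E) 0 := by
  have h : @Eq (ℝ →L[ℝ] E) (mfderiv 𝓘(ℝ, ℝ) 𝓘(ℝ, E) c 0)
      (fderivWithin ℝ (writtenInExtChartAt 𝓘(ℝ, ℝ) 𝓘(ℝ, E) 0 c) (Set.range 𝓘(ℝ, ℝ)) 0) :=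
    ((hc 0).mdifferentiableAt (by simp)).mfderiv
  have h2 : writtenInExtChartAt 𝓘(ℝ, ℝ) 𝓘(ℝ, E) 0 c = fun w => oneChart E G (c w) := by
    unfold writtenInExtChartAt
    rw [h1]
    rfl
  rw [h2, modelWithCornersSelf_coe, Set.range_id, fderivWithin_univ] at h
  have h3 : ContMDiffAt 𝓘(ℝ, ℝ) 𝓘(ℝ, E) ∞ (fun w => oneChart E G (c w)) 0 :=
    (contMDiffAt_oneChart (by rw [h1]; exact mem_extChartAt_source 1)).comp 0 (hc 0)
  have h4 := (h3.contDiffAt.differentiableAt (by simp)).hasFDerivAt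
  exact (h ▸ h4).hasDerivAt

end ChartAtOne

/-! ### The velocity cocycle and the adjoint action -/

section Velocity

open Filter NormedSpace

variable {E : Type*} [NormedAddCommGroup E] [NormedSpace ℝ E]
  {G : Type*} [TopologicalSpace G] [ChartedSpace E G] [Group G]

namespace AutFlow

theorem map_zero_apply (φ : AutFlow E G) (g : G) : φ 0 g = g := by
  have h := φ.map_add 0 0 g
  rw [add_zero] at h
  exact ((φ 0).injective h).symm

theorem continuous_uncurry (φ : AutFlow E G) : Continuous fun p : ℝ × G => φ p.1 p.2 :=
  φ.smooth.continuous

theorem continuous_orbit (φ : AutFlow E G) (g : G) : Continuous fun t => φ t g :=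
  φ.continuous_uncurry.comp (by fun_prop : Continuous fun t : ℝ => (t, g))

theorem contMDiff_apply (φ : AutFlow E G) (t : ℝ) : ContMDiff 𝓘(ℝ, E) 𝓘(ℝ, E) ∞ (φ t) :=
  φ.smooth.comp (contMDiff_const.prodMk contMDiff_id)

theorem contMDiff_orbit (φ : AutFlow E G) (g : G) :
    ContMDiff 𝓘(ℝ, ℝ) 𝓘(ℝ, E) ∞ (fun t => φ t g) :=
  φ.smooth.comp (contMDiff_id.prodMk contMDiff_const)

theorem differential_eq_coordDeriv (φ : AutFlow E G) (t : ℝ) :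
    φ.differential t = coordDeriv (φ t) :=
  mfderiv_one_eq_coordDeriv (φ.contMDiff_apply t 1) (map_one _)

/-- The velocity at time zero of the orbit of `x`, left translated to the identity. -/
def velocity (φ : AutFlow E G) (x : G) : E :=
  deriv (fun t => oneChart E G (x⁻¹ * φ t x)) 0

theorem velocity_mul_of_fixed (φ : AutFlow E G) {b : G} (hb : ∀ t, φ t b = b) (x : G) :
    φ.velocity (b * x) = φ.velocity x := by
  unfold velocity
  congr 1
  funext t
  rw [map_mul, hb t]
  congr 1
  group

theorem velocity_of_fixed (φ : AutFlow E G) {b : G} (hb : ∀ t, φ t b = b) :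
    φ.velocity b = 0 := by
  simp [velocity, hb]

theorem velocity_one (φ : AutFlow E G) : φ.velocity 1 = 0 :=
  φ.velocity_of_fixed fun t => map_one (φ.toEquiv t)

end AutFlow

/-- The adjoint action of `G` on its tangent space at the identity. -/
def adj (g : G) : E →L[ℝ] E := coordDeriv (fun y : G => g * y * g⁻¹)

theorem adj_one_apply (v : E) : adj (1 : G) v = v := by
  have : (fun y : G => 1 * y * 1⁻¹) = fun y => y := by funext y; simp
  rw [adj, this, coordDeriv_id]

variable [LieGroup 𝓘(ℝ, E) ∞ G]

theorem contMDiff_mul_const_left (g : G) :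
    ContMDiff 𝓘(ℝ, E) 𝓘(ℝ, E) ∞ (fun y : G => g * y) :=
  contMDiff_const.mul contMDiff_id

theorem contMDiff_conj (g : G) :
    ContMDiff 𝓘(ℝ, E) 𝓘(ℝ, E) ∞ (fun y : G => g * y * g⁻¹) :=
  (contMDiff_const.mul contMDiff_id).mul contMDiff_const

theorem continuousAt_coordDeriv_mul_left :
    ContinuousAt (fun g : G => coordDeriv (E := E) (fun y : G => g * y)) 1 := by
  refine continuousAt_fderiv_oneChart (Ψ := fun g w => g * (oneChart E G).symm w) ?_ ?_
  · exact contMDiffAt_fst.mul ((contMDiffAt_extChartAt_symm (1 : G)).comp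
      ((1 : G), oneChart E G 1) contMDiffAt_snd)
  · rw [oneChart_symm_one, mul_one]
    exact mem_extChartAt_source 1

theorem continuousAt_adj_one : ContinuousAt (fun g : G => adj (E := E) g) 1 := by
  refine continuousAt_fderiv_oneChart (Ψ := fun g w => g * (oneChart E G).symm w * g⁻¹) ?_ ?_
  · exact (contMDiffAt_fst.mul ((contMDiffAt_extChartAt_symm (1 : G)).comp
      ((1 : G), oneChart E G 1) contMDiffAt_snd)).mul contMDiffAt_fst.inv
  · rw [oneChart_symm_one, mul_one, mul_inv_cancel]
    exact mem_extChartAt_source 1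

theorem adj_mul_apply (g h : G) (v : E) : adj (g * h) v = adj g (adj h v) := by
  have e : (fun y : G => g * h * y * (g * h)⁻¹) =
      fun y => (fun y => g * y * g⁻¹) ((fun y => h * y * h⁻¹) y) := by
    funext y; group
  rw [adj, e, coordDeriv_comp (contMDiff_conj g 1) (contMDiff_conj h 1)
    (by simp) (by simp)]
  rfl

namespace AutFlow

theorem differential_comp (φ ψ : AutFlow E G) (s t : ℝ) (v : E) :
    coordDeriv (fun g => φ s (ψ t g)) v = φ.differential s (ψ.differential t v) := by
  rw [differential_eq_coordDeriv, differential_eq_coordDeriv,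
    coordDeriv_comp (φ.contMDiff_apply s 1) (ψ.contMDiff_apply t 1)
    (by simp) (by simp)]

theorem differential_adj (φ : AutFlow E G) (t : ℝ) (g : G) (v : E) :
    φ.differential t (adj g v) = adj (φ t g) (φ.differential t v) := by
  rw [differential_eq_coordDeriv, adj, adj,
    ← coordDeriv_comp (φ.contMDiff_apply t 1) (contMDiff_conj g 1)
    (by simp) (by simp),
    ← coordDeriv_comp (contMDiff_conj (φ t g) 1) (φ.contMDiff_apply t 1)
    (by simp) (by simp)]
  congr 2
  funext y
  simp

theorem contMDiff_inv_mul_orbit (φ : AutFlow E G) (x : G) :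
    ContMDiff 𝓘(ℝ, ℝ) 𝓘(ℝ, E) ∞ (fun t => x⁻¹ * φ t x) :=
  contMDiff_const.mul (φ.contMDiff_orbit x)

theorem hasDerivAt_velocity (φ : AutFlow E G) (x : G) :
    HasDerivAt (fun t => oneChart E G (x⁻¹ * φ t x)) (φ.velocity x) 0 :=
  (hasDerivAt_oneChart_of_mfderiv (φ.contMDiff_inv_mul_orbit x)
    (by simp [map_zero_apply])).differentiableAt.hasDerivAt

theorem continuous_velocity (φ : AutFlow E G) : Continuous φ.velocity := by
  refine continuous_iff_continuousAt.2 fun x => ?_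
  have h : ContinuousAt (fun x => fderiv ℝ (fun t => oneChart E G (x⁻¹ * φ t x)) 0) x := by
    refine continuousAt_fderiv_oneChart (Ψ := fun x t => x⁻¹ * φ t x) ?_ ?_
    · exact contMDiffAt_fst.inv.mul (φ.smooth.comp (contMDiff_snd.prodMk contMDiff_fst) (x, 0))
    · simp [map_zero_apply]
  exact h.clm_apply continuousAt_const

theorem velocity_map (φ ψ : AutFlow E G) {s : ℝ} (h : ∀ t g, φ t (ψ s g) = ψ s (φ t g)) (x : G) :
    φ.velocity (ψ s x) = ψ.differential s (φ.velocity x) := by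
  have h1 := hasDerivAt_oneChart_comp (ψ.contMDiff_apply s 1)
    (by simp)
    (φ.contMDiff_inv_mul_orbit x).continuous.continuousAt (by simp [map_zero_apply])
    (φ.hasDerivAt_velocity x)
  rw [differential_eq_coordDeriv, ← h1.deriv, velocity]
  simp only [h, map_mul, map_inv]

/-- Differentiate (xy)⁻¹φ_t(xy) = y⁻¹(x⁻¹φ_t(x))y · y⁻¹φ_t(y). -/
theorem velocity_mul (φ : AutFlow E G) (x y : G) :
    φ.velocity (x * y) = adj y⁻¹ (φ.velocity x) + φ.velocity y := by
  have hc := (φ.contMDiff_inv_mul_orbit x).continuous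
  have h1 := hasDerivAt_oneChart_comp (contMDiff_conj y⁻¹ 1)
    (by simp) hc.continuousAt (by simp [map_zero_apply])
    (φ.hasDerivAt_velocity x)
  have h2 := hasDerivAt_oneChart_mul
    ((contMDiff_conj (E := E) y⁻¹).continuous.comp hc).continuousAt
    (φ.contMDiff_inv_mul_orbit y).continuous.continuousAt (by simp [map_zero_apply])
    (by simp [map_zero_apply]) h1 (φ.hasDerivAt_velocity y)
  rw [adj, ← h2.deriv, velocity]
  congr 1
  funext t
  rw [map_mul]
  congr 1
  simp only [Function.comp]
  group

/-- Since g φ_s(x) = gφ_t(x) · φ_t(x⁻¹φ_{s-t}(x)), the velocity at time zero determines the speed of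
the orbit at every time. -/
theorem hasDerivAt_mul_orbit (φ : AutFlow E G) (g x : G) (t : ℝ)
    (hs : g * φ t x ∈ (oneChart E G).source) :
    HasDerivAt (fun s => oneChart E G (g * φ s x))
      (coordDeriv (fun y => (g * φ t x) * y) (φ.differential t (φ.velocity x))) t := by
  have h1 := hasDerivAt_oneChart_comp (Ψ := fun y => (g * φ t x) * φ t y)
    ((contMDiff_mul_const_left _).comp (φ.contMDiff_apply t) 1) (by simpa using hs)
    (φ.contMDiff_inv_mul_orbit x).continuous.continuousAt (by simp [map_zero_apply])
    (φ.hasDerivAt_velocity x)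
  rw [coordDeriv_comp (contMDiff_mul_const_left _ 1) (φ.contMDiff_apply t 1) (by simpa using hs)
    (by simp), ← differential_eq_coordDeriv] at h1
  rw [← sub_self t] at h1
  refine (h1.comp_sub_const t t).congr_of_eventuallyEq (.of_forall fun s => ?_)
  simp only [map_mul, map_inv, ← φ.map_add]
  rw [add_sub_cancel]
  congr 1
  group

/-- The orbit has zero derivative in the chart for small times, so the times that fix x contain a
neighbourhood of 0. They form an open subgroup of ℝ, which is all of ℝ. -/
theorem fixed_of_velocity_eq_zero (φ : AutFlow E G) {x : G} (hx : φ.velocity x = 0) (t : ℝ) :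
    φ t x = x := by
  let S : AddSubgroup ℝ :=
    { carrier := {t | φ t x = x}
      zero_mem' := φ.map_zero_apply x
      add_mem' := fun {a b} ha hb => by
        change φ (a + b) x = x
        rw [φ.map_add, show φ b x = x from hb]
        exact ha
      neg_mem' := fun {a} ha => by
        change φ (-a) x = x
        conv_lhs => rw [← show φ a x = x from ha, ← φ.map_add, neg_add_cancel]
        exact φ.map_zero_apply x }
  have hnhds : (S : Set ℝ) ∈ 𝓝 0 := by
    have hc := (φ.contMDiff_inv_mul_orbit x).continuous
    have h1 : ∀ᶠ s in 𝓝 (0 : ℝ), x⁻¹ * φ s x ∈ (oneChart E G).source :=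
      hc.continuousAt.eventually_mem (by
        simpa [map_zero_apply] using oneChart_source_mem_nhds)
    obtain ⟨ε, hε, hball⟩ := Metric.eventually_nhds_iff_ball.1 h1
    filter_upwards [Metric.ball_mem_nhds (0 : ℝ) hε] with s hs
    have hd : ∀ u ∈ Metric.ball (0 : ℝ) ε,
        HasDerivAt (fun s => oneChart E G (x⁻¹ * φ s x)) 0 u := fun u hu => by
      have := φ.hasDerivAt_mul_orbit x⁻¹ x u (hball u hu)
      rwa [hx, _root_.map_zero, _root_.map_zero] at this
    have heq := (convex_ball (0 : ℝ) ε).is_const_of_fderivWithin_eq_zero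
      (fun u hu => (hd u hu).differentiableAt.differentiableWithinAt)
      (fun u hu => by
        rw [fderivWithin_of_isOpen Metric.isOpen_ball hu, (hd u hu).hasFDerivAt.fderiv]
        simp) hs (Metric.mem_ball_self hε)
    have := (oneChart E G).injOn (hball s hs) (hball 0 (Metric.mem_ball_self hε)) heq
    rw [φ.map_zero_apply] at this
    exact mul_left_cancel this
  have hopen := AddSubgroup.isOpen_of_mem_nhds S hnhds
  have htop : (S : Set ℝ) = Set.univ :=
    IsClopen.eq_univ ⟨AddSubgroup.isClosed_of_isOpen S hopen, hopen⟩ ⟨0, S.zero_mem⟩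
  exact (htop ▸ Set.mem_univ t : t ∈ (S : Set ℝ))

end AutFlow

end Velocity

/-! ### From small velocity to small distance -/

section Bootstrap

open Filter NormedSpace

variable {E : Type*} [NormedAddCommGroup E] [NormedSpace ℝ E]
  {G : Type*} [TopologicalSpace G] [ChartedSpace E G] [Group G]

/-- Points whose coordinates are close to those of the identity are close to the identity. -/
theorem exists_forall_oneChart_mem {U : Set G} (hU : U ∈ 𝓝 (1 : G)) :
    ∃ ε > 0, ∀ g ∈ (oneChart E G).source, ‖oneChart E G g - oneChart E G 1‖ < ε → g ∈ U := by
  have h : (oneChart E G).symm ⁻¹' U ∈ 𝓝 (oneChart E G 1) :=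
    (continuousAt_extChartAt_symm (I := 𝓘(ℝ, E)) (1 : G)).preimage_mem_nhds
      (by rw [oneChart_symm_one]; exact hU)
  obtain ⟨ε, hε, hball⟩ := Metric.mem_nhds_iff.1 h
  refine ⟨ε, hε, fun g hg hgε => ?_⟩
  have := hball (mem_ball_iff_norm.2 hgε)
  rwa [Set.mem_preimage, (oneChart E G).left_inv hg] at this

/-- Supplies the constant that converts velocities translated to the identity into speeds in the
chart. -/
theorem exists_norm_coordDeriv_mul_left_le [LieGroup 𝓘(ℝ, E) ∞ G] :
    ∃ R > 0, ∃ C > 0, Metric.closedBall (oneChart E G 1) R ⊆ (oneChart E G).target ∧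
      ∀ g ∈ (oneChart E G).source, ‖oneChart E G g - oneChart E G 1‖ < R →
        ‖coordDeriv (E := E) (fun y : G => g * y)‖ ≤ C := by
  obtain ⟨R₁, hR₁, hball⟩ := Metric.nhds_basis_closedBall.mem_iff.1
    (extChartAt_target_mem_nhds (I := 𝓘(ℝ, E)) (1 : G))
  have h : ∀ᶠ g in 𝓝 (1 : G), ‖coordDeriv (E := E) (fun y : G => g * y)‖ <
      ‖coordDeriv (E := E) (fun y : G => 1 * y)‖ + 1 :=
    continuousAt_coordDeriv_mul_left.norm.eventually_lt_const (by linarith)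
  obtain ⟨R₂, hR₂, hC⟩ := exists_forall_oneChart_mem (E := E) h
  exact ⟨min R₁ R₂, lt_min hR₁ hR₂, _, by positivity,
    (Metric.closedBall_subset_closedBall (min_le_left _ _)).trans hball,
    fun g hg hgR => (hC g hg (hgR.trans_le (min_le_right _ _))).le⟩

/-- A curve that starts near the identity and is slow as long as it stays near the identity does
stay near the identity. -/
theorem norm_oneChart_sub_le_of_deriv_le [FiniteDimensional ℝ E] [T2Space G] {R : ℝ}
    (hR : Metric.closedBall (oneChart E G 1) R ⊆ (oneChart E G).target)
    {c : ℝ → G} (hc : Continuous c) {b b' : ℝ → ℝ} (hb : ∀ t, HasDerivAt b (b' t) t) {T : ℝ}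
    (h0 : c 0 ∈ (oneChart E G).source) (hb0 : ‖oneChart E G (c 0) - oneChart E G 1‖ ≤ b 0)
    (hbR : ∀ t ∈ Set.Icc 0 T, b t < R)
    (hder : ∀ t ∈ Set.Icc 0 T, c t ∈ (oneChart E G).source →
      ‖oneChart E G (c t) - oneChart E G 1‖ < R →
      ∃ v, HasDerivAt (fun s => oneChart E G (c s)) v t ∧ ‖v‖ ≤ b' t) :
    ∀ t ∈ Set.Icc 0 T, c t ∈ (oneChart E G).source ∧
      ‖oneChart E G (c t) - oneChart E G 1‖ ≤ b t := by
  have hprop : ProperSpace E := FiniteDimensional.proper ℝ E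
  have hchart : ContinuousOn (oneChart E G) (oneChart E G).source := continuousOn_extChartAt 1
  have hopen : IsOpen (oneChart E G).source := isOpen_extChartAt_source 1
  let S : Set ℝ := {t | c t ∈ (oneChart E G).source ∧
    ‖oneChart E G (c t) - oneChart E G 1‖ ≤ b t}
  have hbc : Continuous b := continuous_iff_continuousAt.2 fun t => (hb t).continuousAt
  have hcomp : IsCompact ((oneChart E G).symm '' Metric.closedBall (oneChart E G 1) R) :=
    (isCompact_closedBall _ _).image_of_continuousOn
      ((continuousOn_extChartAt_symm (I := 𝓘(ℝ, E)) (1 : G)).mono hR)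
  -- A limit of good times stays in the chart domain because the image of the closed R-ball is
  -- compact, hence closed in G.
  have hclosed : IsClosed (S ∩ Set.Icc 0 T) := by
    refine isClosed_of_closure_subset fun t ht => ?_
    have htI : t ∈ Set.Icc 0 T :=
      isClosed_Icc.closure_subset_iff.2 Set.inter_subset_right ht
    have hmem : c t ∈ (oneChart E G).symm '' Metric.closedBall (oneChart E G 1) R := by
      refine (hcomp.isClosed.preimage hc).closure_subset_iff.2 (fun s hs => ?_) ht
      exact ⟨oneChart E G (c s), mem_closedBall_iff_norm.2 (hs.1.2.trans (hbR s hs.2).le),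
        (oneChart E G).left_inv hs.1.1⟩
    have hsrc : c t ∈ (oneChart E G).source := by
      obtain ⟨w, hw, e⟩ := hmem
      rw [← e]
      exact (oneChart E G).map_target (hR hw)
    refine ⟨⟨hsrc, ?_⟩, htI⟩
    have hcont : ContinuousAt (fun s => oneChart E G (c s)) t :=
      ContinuousAt.comp (g := oneChart E G) (hchart.continuousAt (hopen.mem_nhds hsrc))
        hc.continuousAt
    have := mem_closure_iff_clusterPt.1 ht
    rw [ClusterPt, ← nhdsWithin] at this
    exact le_of_tendsto_of_tendsto
      ((hcont.sub continuousAt_const).norm.mono_left nhdsWithin_le_nhds)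
      (hbc.continuousAt.mono_left nhdsWithin_le_nhds)
      (eventually_nhdsWithin_of_forall fun s (hs : s ∈ S ∩ Set.Icc 0 T) => hs.1.2)
  refine hclosed.Icc_subset_of_forall_mem_nhdsWithin ⟨h0, hb0⟩ ?_
  rintro t ⟨⟨hsrc, hle⟩, ht0, htT⟩
  have hcont : ContinuousAt (fun s => oneChart E G (c s)) t :=
    ContinuousAt.comp (g := oneChart E G) (hchart.continuousAt (hopen.mem_nhds hsrc))
      hc.continuousAt
  have hnear : ∀ᶠ s in 𝓝 t, c s ∈ (oneChart E G).source ∧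
      ‖oneChart E G (c s) - oneChart E G 1‖ < R ∧ s < T :=
    (hc.continuousAt.eventually_mem (hopen.mem_nhds hsrc)).and
      (((hcont.sub continuousAt_const).norm.eventually_lt_const
        (hle.trans_lt (hbR t ⟨ht0, htT.le⟩))).and (eventually_lt_nhds htT))
  obtain ⟨ε, hε, hball⟩ := Metric.eventually_nhds_iff_ball.1 hnear
  have hsub : Set.Icc t (t + ε / 2) ⊆ Metric.ball t ε := fun s hs => by
    rw [Metric.mem_ball, Real.dist_eq, abs_lt]
    constructor <;> linarith [hs.1, hs.2]
  choose! f' hf' hf'b using fun s (hs : s ∈ Set.Icc t (t + ε / 2)) =>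
    hder s ⟨ht0.trans hs.1, (hball s (hsub hs)).2.2.le⟩ (hball s (hsub hs)).1
      (hball s (hsub hs)).2.1
  have hmain := image_norm_le_of_norm_deriv_right_le_deriv_boundary
    (f := fun s => oneChart E G (c s) - oneChart E G 1) (f' := f') (a := t) (b := t + ε / 2)
    (B := b) (B' := b')
    (fun s hs => ((hf' s hs).continuousAt.sub continuousAt_const).continuousWithinAt)
    (fun s hs => ((hf' s (Set.Ico_subset_Icc_self hs)).sub_const _).hasDerivWithinAt) hle hb
    (fun s hs => hf'b s (Set.Ico_subset_Icc_self hs))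
  refine mem_of_superset (Icc_mem_nhdsGT (by linarith : t < t + ε / 2)) fun s hs => ?_
  exact ⟨(hball s (hsub hs)).1, hmain hs⟩

variable [FiniteDimensional ℝ E] [T2Space G] [LieGroup 𝓘(ℝ, E) ∞ G]

/-- One-parameter subgroups with small initial velocity are close to the identity at time `1`. -/
theorem exists_forall_oneParameter_mem {U : Set G} (hU : U ∈ 𝓝 (1 : G)) :
    ∃ r > 0, ∀ γ : ℝ → G, (∀ s t, γ (s + t) = γ s * γ t) → ∀ v : E, Continuous γ →
      HasDerivAt (fun s => oneChart E G (γ s)) v 0 → ‖v‖ < r → γ 1 ∈ U := by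
  obtain ⟨ε, hε, hεU⟩ := exists_forall_oneChart_mem (E := E) hU
  obtain ⟨R, hR, C, hC, hball, hbd⟩ := exists_norm_coordDeriv_mul_left_le (E := E) (G := G)
  refine ⟨min ε R / C, by positivity, fun γ hγ v hcont hv hlt => ?_⟩
  rw [lt_div_iff₀ hC, mul_comm] at hlt
  have h1 : γ 0 = 1 := by simpa using hγ 0 0
  have hder : ∀ t, γ t ∈ (oneChart E G).source →
      HasDerivAt (fun s => oneChart E G (γ s)) (coordDeriv (fun y => γ t * y) v) t := by
    intro t hs
    have h2 := hasDerivAt_oneChart_comp (contMDiff_mul_const_left (γ t) 1) (by simpa using hs)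
      hcont.continuousAt h1 hv
    rw [← sub_self t] at h2
    refine (h2.comp_sub_const t t).congr_of_eventuallyEq (.of_forall fun s => ?_)
    simp only [← hγ]
    rw [add_sub_cancel]
  have hb : ∀ t, HasDerivAt (fun t => C * ‖v‖ * t) (C * ‖v‖) t := fun t => by
    simpa using (hasDerivAt_id t).const_mul (C * ‖v‖)
  have hle : ∀ t ∈ Set.Icc (0 : ℝ) 1, C * ‖v‖ * t ≤ C * ‖v‖ := fun t ht =>
    mul_le_of_le_one_right (by positivity) ht.2
  have key := norm_oneChart_sub_le_of_deriv_le hball hcont hb (T := 1)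
    (by rw [h1]; exact mem_extChartAt_source 1) (by simp [h1])
    (fun t ht => (hle t ht).trans_lt (hlt.trans_le (min_le_right _ _)))
    (fun t ht hs hR => ⟨_, hder t hs, (coordDeriv _).le_of_opNorm_le (hbd _ hs hR) v⟩)
    1 ⟨zero_le_one, le_rfl⟩
  exact hεU _ key.1 (key.2.trans_lt
    ((hle 1 ⟨zero_le_one, le_rfl⟩).trans_lt (hlt.trans_le (min_le_left _ _))))

/-- The orbits of `H` that converge to the identity and have small velocity are close to the
identity. -/
theorem AutFlow.exists_forall_velocity_lt_mem {H : AutFlow E G} {D : E →L[ℝ] E}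
    (hD : H.HasDerivation D) {U : Set G} (hU : U ∈ 𝓝 (1 : G)) :
    ∃ r > 0, ∀ x, Tendsto (fun t => H t x) atTop (𝓝 1) →
      H.velocity x ∈ contractingSpace D → ‖H.velocity x‖ < r → x ∈ U := by
  obtain ⟨ε, hε, hεU⟩ := exists_forall_oneChart_mem (E := E) hU
  obtain ⟨R, hR, C, hC, hball, hbd⟩ := exists_norm_coordDeriv_mul_left_le (E := E) (G := G)
  obtain ⟨k, hk, M, hM, hdecay⟩ := exists_norm_exp_smul_le D
  -- The orbit moves in the chart with speed at most C M exp(-kt)‖v‖, so its total length is at most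
  -- (CM/k)‖v‖. This gets half of min ε R; the other half is for the distance from 1 at a late time
  -- T, from which the orbit is followed backwards.
  refine ⟨min ε R / (2 * (C * M / k)), by positivity, fun x hx hxD hlt => ?_⟩
  rw [lt_div_iff₀ (by positivity)] at hlt
  set δ := min ε R with hδ
  have hδ0 : 0 < δ := lt_min hε hR
  set A := C * M / k * ‖H.velocity x‖ with hA
  have hAδ : A < δ / 2 := by rw [hA]; linarith
  have hnear : ∀ᶠ g in 𝓝 (1 : G), g ∈ (oneChart E G).source ∧
      ‖oneChart E G g - oneChart E G 1‖ < δ / 2 :=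
    (eventually_mem_set.2 oneChart_source_mem_nhds).and
      (((continuousAt_extChartAt (I := 𝓘(ℝ, E)) (1 : G)).sub
        continuousAt_const).norm.eventually_lt_const (by simpa using hδ0))
  obtain ⟨T, ⟨hTs, hTn⟩, hT0⟩ := ((hx.eventually hnear).and (eventually_ge_atTop 0)).exists
  have hb : ∀ s, HasDerivAt (fun s => δ / 2 + A * Real.exp (-(k * (T - s))))
      (C * (M * Real.exp (-(k * (T - s))) * ‖H.velocity x‖)) s := by
    intro s
    have h1 : HasDerivAt (fun s : ℝ => -(k * (T - s))) k s := by
      simpa using (((hasDerivAt_id s).const_sub T).const_mul k).fun_neg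
    refine ((h1.exp.const_mul A).const_add (δ / 2)).congr_deriv ?_
    rw [hA]
    field_simp
  have hble : ∀ s ∈ Set.Icc 0 T, δ / 2 + A * Real.exp (-(k * (T - s))) < δ := by
    intro s hs
    have h1 : Real.exp (-(k * (T - s))) ≤ 1 := by
      rw [Real.exp_le_one_iff, neg_nonpos]
      exact mul_nonneg hk.le (by linarith [hs.2])
    have h2 : A * Real.exp (-(k * (T - s))) ≤ A := mul_le_of_le_one_right (by positivity) h1
    linarith
  have key := norm_oneChart_sub_le_of_deriv_le hball (c := fun s => H (T - s) x)
    ((H.continuous_orbit x).comp (by fun_prop : Continuous fun s : ℝ => T - s)) hb (T := T)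
    (by simpa using hTs)
    (by
      have : 0 ≤ A * Real.exp (-(k * (T - 0))) := by positivity
      simp only [sub_zero] at this ⊢
      linarith)
    (fun s hs => (hble s hs).trans_le (min_le_right _ _)) ?_ T ⟨hT0, le_rfl⟩
  · simp only [sub_self, H.map_zero_apply] at key
    refine hεU _ key.1 (key.2.trans_lt ?_)
    have := hble T ⟨hT0, le_rfl⟩
    simp only [sub_self] at this
    exact this.trans_le (min_le_left _ _)
  · intro s hs hsrc hsR
    have h1 := H.hasDerivAt_mul_orbit 1 x (T - s) (by simpa using hsrc)
    simp only [one_mul] at h1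
    refine ⟨_, h1.comp_const_sub T s, ?_⟩
    rw [norm_neg]
    refine ((coordDeriv _).le_of_opNorm_le (hbd _ hsrc hsR) _).trans ?_
    rw [hD]
    gcongr
    exact hdecay _ hxD _ (by linarith [hs.2])

end Bootstrap

/-! ### Open mapping theorem for a product of two closed subgroups -/

section OpenFactorization

open Filter

variable {G : Type*} [TopologicalSpace G] [Group G] [IsTopologicalGroup G]

theorem IsCompact.pow_set {K : Set G} (hK : IsCompact K) (n : ℕ) : IsCompact (K ^ n) := by
  induction n with
  | zero => simp [← Set.singleton_one]
  | succ n ih =>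
    rw [pow_succ]
    exact ih.mul hK

/-- The powers of a symmetric compact neighbourhood of 1 exhaust an open, hence closed, subgroup. -/
theorem sigmaCompactSpace_of_connected [ConnectedSpace G] [LocallyCompactSpace G] :
    SigmaCompactSpace G := by
  obtain ⟨C, hC, hC1⟩ := exists_compact_mem_nhds (1 : G)
  let K : Set G := C ∪ C⁻¹
  have hK : IsCompact K := hC.union hC.inv
  have hKinv : K⁻¹ = K := by simp [K, Set.union_comm]
  let S : Subgroup G :=
    { carrier := ⋃ n : ℕ, K ^ n
      one_mem' := Set.mem_iUnion.2 ⟨0, by simp⟩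
      mul_mem' := fun {a b} ha hb => by
        obtain ⟨m, hm⟩ := Set.mem_iUnion.1 ha
        obtain ⟨n, hn⟩ := Set.mem_iUnion.1 hb
        exact Set.mem_iUnion.2 ⟨m + n, by rw [pow_add]; exact Set.mul_mem_mul hm hn⟩
      inv_mem' := fun {a} ha => by
        obtain ⟨m, hm⟩ := Set.mem_iUnion.1 ha
        refine Set.mem_iUnion.2 ⟨m, ?_⟩
        rw [← hKinv, inv_pow]
        exact Set.inv_mem_inv.2 hm }
  have hmem : (S : Set G) ∈ 𝓝 1 := mem_of_superset hC1 fun x hx =>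
    Set.mem_iUnion.2 ⟨1, by rw [pow_one]; exact Or.inl hx⟩
  have hopen := Subgroup.isOpen_of_mem_nhds S hmem
  have htop : (⋃ n : ℕ, K ^ n) = Set.univ :=
    IsClopen.eq_univ (s := (S : Set G)) ⟨Subgroup.isClosed_of_isOpen S hopen, hopen⟩
      ⟨1, S.one_mem⟩
  rw [← isSigmaCompact_univ_iff, ← htop]
  exact isSigmaCompact_iUnion_of_isCompact _ fun n => hK.pow_set n

/-- If a locally compact σ-compact group is the product of two closed subgroups, then the elements
close to `1` have factors close to `1`. -/
theorem eventually_exists_mul_of_isClosed [T2Space G] [LocallyCompactSpace G]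
    [SigmaCompactSpace G] {A B : Subgroup G} (hA : IsClosed (A : Set G))
    (hB : IsClosed (B : Set G)) (hAB : ∀ x : G, ∃ a ∈ A, ∃ b ∈ B, x = a * b)
    {U : Set G} (hU : U ∈ 𝓝 (1 : G)) :
    ∀ᶠ x in 𝓝 (1 : G), ∃ a ∈ A, a ∈ U ∧ ∃ b ∈ B, b ∈ U ∧ x = a * b := by
  have : SigmaCompactSpace A := hA.isClosedEmbedding_subtypeVal.sigmaCompactSpace
  have : SigmaCompactSpace B := hB.isClosedEmbedding_subtypeVal.sigmaCompactSpace
  -- The action (a, b)·x = a x b⁻¹ is transitive because G = AB, so its orbit map at 1 is open.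
  let _ : MulAction (A × B) G :=
    { smul := fun p x => p.1 * x * (p.2 : G)⁻¹
      one_smul := fun x => by change ((1 : A) : G) * x * ((1 : B) : G)⁻¹ = x; simp
      mul_smul := fun p q x => by
        change ((p.1 * q.1 : A) : G) * x * ((p.2 * q.2 : B) : G)⁻¹ =
          p.1 * (q.1 * x * (q.2 : G)⁻¹) * (p.2 : G)⁻¹
        push_cast
        group }
  have hsmul : ∀ (p : A × B) (x : G), p • x = p.1 * x * (p.2 : G)⁻¹ := fun _ _ => rfl
  have : ContinuousSMul (A × B) G :=
    ⟨by
      change Continuous fun p : (A × B) × G => (p.1.1 : G) * p.2 * (p.1.2 : G)⁻¹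
      fun_prop⟩
  have : MulAction.IsPretransitive (A × B) G := by
    refine (MulAction.isPretransitive_iff_base (1 : G)).2 fun x => ?_
    obtain ⟨a, ha, b, hb, rfl⟩ := hAB x
    exact ⟨(⟨a, ha⟩, ⟨b⁻¹, B.inv_mem hb⟩), by simp [hsmul]⟩
  have hV : {p : A × B | (p.1 : G) ∈ U ∧ (p.2 : G)⁻¹ ∈ U} ∈ 𝓝 (1 : A × B) := by
    have h1 : ContinuousAt (fun p : A × B => (p.1 : G)) 1 :=
      (by fun_prop : Continuous fun p : A × B => (p.1 : G)).continuousAt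
    have h2 : ContinuousAt (fun p : A × B => (p.2 : G)⁻¹) 1 :=
      (by fun_prop : Continuous fun p : A × B => (p.2 : G)⁻¹).continuousAt
    exact (h1.eventually_mem (by simpa using hU)).and (h2.eventually_mem (by simpa using hU))
  filter_upwards [smul_singleton_mem_nhds_of_sigmaCompact hV (1 : G)] with x hx
  obtain ⟨p, hp, y, rfl, rfl⟩ := hx
  exact ⟨p.1, p.1.2, hp.1, (p.2 : G)⁻¹, B.inv_mem p.2.2, hp.2, by simp [hsmul]⟩

end OpenFactorization

/-! ### Attracted and convergent points -/

section DynamicalSubgroups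

open Filter NormedSpace

variable {E : Type*} [NormedAddCommGroup E] [NormedSpace ℝ E]
  {G : Type*} [TopologicalSpace G] [ChartedSpace E G] [Group G]

namespace AutFlow

/-- The time reversal of a flow. -/
def rev (φ : AutFlow E G) : AutFlow E G where
  toEquiv t := φ (-t)
  map_add s t g := by rw [neg_add, φ.map_add]
  smooth := φ.smooth.comp ((contDiff_neg.contMDiff.comp contMDiff_fst).prodMk contMDiff_snd)

theorem rev_apply (φ : AutFlow E G) (t : ℝ) (g : G) : φ.rev t g = φ (-t) g := rfl

theorem rev_rev (φ : AutFlow E G) : φ.rev.rev = φ := by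
  cases φ
  simp [rev]

theorem differential_rev (φ : AutFlow E G) (t : ℝ) :
    φ.rev.differential t = φ.differential (-t) := rfl

theorem HasDerivation.rev {φ : AutFlow E G} {D : E →L[ℝ] E} (h : φ.HasDerivation D) :
    φ.rev.HasDerivation (-D) := fun t => by
  rw [differential_rev, h, smul_neg, neg_smul]

/-- The fixed points of a flow. -/
def fixedSubgroup (H : AutFlow E G) : Subgroup G where
  carrier := {g | ∀ t, H t g = g}
  one_mem' t := map_one (H.toEquiv t)
  mul_mem' ha hb t := by rw [map_mul, ha t, hb t]
  inv_mem' ha t := by rw [map_inv, ha t]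

theorem fixedSubgroup_rev (H : AutFlow E G) : H.rev.fixedSubgroup = H.fixedSubgroup := by
  ext g
  refine ⟨fun h t => ?_, fun h t => h (-t)⟩
  simpa [rev_apply] using h (-t)

theorem map_mem_fixedSubgroup {φ H : AutFlow E G} (hcomm : ∀ s t g, H s (φ t g) = φ t (H s g))
    (t : ℝ) {x : G} (hx : x ∈ H.fixedSubgroup) : φ t x ∈ H.fixedSubgroup :=
  fun s => by rw [hcomm, hx s]

section

variable [IsTopologicalGroup G]

/-- The points whose orbits converge to the identity in positive time. -/
def attracted (H : AutFlow E G) : Subgroup G where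
  carrier := {x | Tendsto (fun t => H t x) atTop (𝓝 1)}
  one_mem' := by simpa using tendsto_const_nhds
  mul_mem' {a b} ha hb := by simpa using Tendsto.mul ha hb
  inv_mem' {a} ha := by simpa using Tendsto.inv ha

/-- The points whose orbits converge to a fixed point in positive time. -/
def convergent (H : AutFlow E G) : Subgroup G where
  carrier := {x | ∃ b ∈ H.fixedSubgroup, Tendsto (fun t => H t x) atTop (𝓝 b)}
  one_mem' := ⟨1, one_mem _, by simpa using tendsto_const_nhds⟩
  mul_mem' := by
    rintro x y ⟨b, hb, hx⟩ ⟨c, hc, hy⟩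
    exact ⟨b * c, mul_mem hb hc, by simpa using hx.mul hy⟩
  inv_mem' := by
    rintro x ⟨b, hb, hx⟩
    exact ⟨b⁻¹, inv_mem hb, by simpa using hx.inv⟩

theorem mem_attracted {H : AutFlow E G} {x : G} :
    x ∈ H.attracted ↔ Tendsto (fun t => H t x) atTop (𝓝 1) := Iff.rfl

theorem attracted_le_convergent (H : AutFlow E G) : H.attracted ≤ H.convergent :=
  fun _ hx => ⟨1, one_mem _, hx⟩

theorem fixedSubgroup_le_convergent (H : AutFlow E G) : H.fixedSubgroup ≤ H.convergent :=
  fun x hx => ⟨x, hx, by simpa [show ∀ t, H t x = x from hx] using tendsto_const_nhds⟩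

theorem exists_mul_of_mem_convergent {H : AutFlow E G} {x : G} (hx : x ∈ H.convergent) :
    ∃ b ∈ H.fixedSubgroup, ∃ a ∈ H.attracted, x = b * a := by
  obtain ⟨b, hb, h⟩ := hx
  refine ⟨b, hb, b⁻¹ * x, ?_, by simp⟩
  have := h.const_mul b⁻¹
  rw [mem_attracted]
  simpa [show ∀ t, H t b = b from hb] using this

theorem eq_one_of_fixed_of_attracted [T2Space G] {H : AutFlow E G} {x : G}
    (h : x ∈ H.fixedSubgroup) (hx : x ∈ H.attracted) : x = 1 := by
  rw [mem_attracted] at hx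
  simp only [show ∀ t, H t x = x from h] at hx
  exact tendsto_nhds_unique tendsto_const_nhds hx

section Commuting

variable {φ H : AutFlow E G} (hcomm : ∀ s t g, H s (φ t g) = φ t (H s g))
include hcomm

theorem map_mem_attracted (t : ℝ) {x : G} (hx : x ∈ H.attracted) : φ t x ∈ H.attracted := by
  rw [mem_attracted] at hx ⊢
  simp only [hcomm]
  have hc : Continuous (φ t) :=
    φ.continuous_uncurry.comp (by fun_prop : Continuous fun g : G => (t, g))
  have h1 := hc.tendsto 1
  rw [map_one] at h1
  exact h1.comp hx

theorem map_mem_convergent (t : ℝ) {x : G} (hx : x ∈ H.convergent) : φ t x ∈ H.convergent := by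
  obtain ⟨b, hb, a, ha, rfl⟩ := exists_mul_of_mem_convergent hx
  rw [map_mul]
  exact mul_mem (H.fixedSubgroup_le_convergent (map_mem_fixedSubgroup hcomm t hb))
    (H.attracted_le_convergent (map_mem_attracted hcomm t ha))

end Commuting

end

variable [LieGroup 𝓘(ℝ, E) ∞ G]

theorem velocity_rev (H : AutFlow E G) (x : G) : H.rev.velocity x = -H.velocity x := by
  have h := H.hasDerivAt_velocity x
  rw [← neg_zero] at h
  have h2 := h.scomp (0 : ℝ) (hasDerivAt_neg 0)
  rw [neg_one_smul] at h2
  exact h2.deriv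

theorem velocity_apply_self {H : AutFlow E G} {D : E →L[ℝ] E} (hD : H.HasDerivation D) (t : ℝ)
    (x : G) : H.velocity (H t x) = exp (t • D) (H.velocity x) := by
  rw [← hD t]
  exact H.velocity_map H (fun s g => by rw [← H.map_add, ← H.map_add, add_comm]) x

variable [IsTopologicalGroup G]

/-- exp(tD) v(x) = v(H_t x) tends to v(b) = 0 by continuity of the velocity. -/
theorem velocity_mem_of_mem_convergent {H : AutFlow E G} {D : E →L[ℝ] E}
    (hD : H.HasDerivation D) {x : G} (hx : x ∈ H.convergent) :
    H.velocity x ∈ contractingSpace D := by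
  obtain ⟨b, hb, h⟩ := hx
  rw [mem_contractingSpace]
  simp only [← velocity_apply_self hD]
  rw [← H.velocity_of_fixed hb]
  exact (H.continuous_velocity.tendsto b).comp h

theorem velocity_mem_of_mem_convergent_rev {H : AutFlow E G} {D : E →L[ℝ] E}
    (hD : H.HasDerivation D) {x : G} (hx : x ∈ H.rev.convergent) :
    H.velocity x ∈ contractingSpace (-D) := by
  have := velocity_mem_of_mem_convergent hD.rev hx
  rwa [velocity_rev, Submodule.neg_mem_iff] at this

/-- exp(tD) Ad(a) w = Ad(H_t a) exp(tD) w, which tends to Ad(1) 0 = 0. -/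
theorem adj_mem_contractingSpace {H : AutFlow E G} {D : E →L[ℝ] E} (hD : H.HasDerivation D)
    {a : G} (ha : a ∈ H.attracted) {w : E} (hw : w ∈ contractingSpace D) :
    adj a w ∈ contractingSpace D := by
  rw [mem_contractingSpace] at hw ⊢
  simp only [← hD _, differential_adj] at hw ⊢
  have h1 : Tendsto (fun t => adj (E := E) (H t a)) atTop (𝓝 (adj (1 : G))) :=
    continuousAt_adj_one.tendsto.comp ha
  have h2 := (isBoundedBilinearMap_apply (𝕜 := ℝ) (E := E) (F := E)).continuous.tendsto
    (adj (1 : G), (0 : E)) |>.comp (h1.prodMk_nhds hw)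
  simpa [Function.comp_def] using h2

variable [FiniteDimensional ℝ E]

section Derivation

variable {H : AutFlow E G} {D : E →L[ℝ] E} (hD : H.HasDerivation D)
include hD

theorem mem_fixedSubgroup_of_mem_convergent {x : G} (hx : x ∈ H.convergent)
    (hx' : x ∈ H.rev.convergent) : x ∈ H.fixedSubgroup :=
  H.fixed_of_velocity_eq_zero (eq_zero_of_mem_contractingSpace
    (velocity_mem_of_mem_convergent hD hx) (velocity_mem_of_mem_convergent_rev hD hx'))

/-- If `G` is the product of the groups of the points that converge to a fixed point in negative
time and of those that converge to the identity in positive time, then the velocity detects the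
points that converge in positive time. -/
theorem mem_convergent_iff (hdec : ∀ x : G, ∃ y ∈ H.rev.convergent, ∃ a ∈ H.attracted, x = y * a)
    {x : G} : x ∈ H.convergent ↔ H.velocity x ∈ contractingSpace D := by
  refine ⟨velocity_mem_of_mem_convergent hD, fun hx => ?_⟩
  obtain ⟨y, hy, a, ha, rfl⟩ := hdec x
  -- Solving the cocycle identity for v(y) shows that it is contracted in positive time. It is also
  -- contracted in negative time, so it vanishes and y is fixed.
  have e : adj a (H.velocity (y * a) - H.velocity a) = H.velocity y := by
    rw [velocity_mul, add_sub_cancel_right, ← adj_mul_apply, mul_inv_cancel, adj_one_apply]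
  have h1 : H.velocity y ∈ contractingSpace D := by
    rw [← e]
    exact adj_mem_contractingSpace hD ha (sub_mem hx
      (velocity_mem_of_mem_convergent hD (H.attracted_le_convergent ha)))
  have h2 : y ∈ H.fixedSubgroup := H.fixed_of_velocity_eq_zero
    (eq_zero_of_mem_contractingSpace h1 (velocity_mem_of_mem_convergent_rev hD hy))
  exact mul_mem (H.fixedSubgroup_le_convergent h2) (H.attracted_le_convergent ha)

theorem isClosed_convergent
    (hdec : ∀ x : G, ∃ y ∈ H.rev.convergent, ∃ a ∈ H.attracted, x = y * a) :
    IsClosed (H.convergent : Set G) := by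
  have e : (H.convergent : Set G) = H.velocity ⁻¹' contractingSpace D :=
    Set.ext fun x => mem_convergent_iff hD hdec
  rw [e]
  exact (Submodule.closed_of_finiteDimensional _).preimage H.continuous_velocity

variable [T2Space G]

/-- For x = ba with b fixed, v(a) = v(x) is small, so a is near 1, and then so is b = xa⁻¹. -/
theorem eventually_exists_fixed_mul_attracted {U : Set G} (hU : U ∈ 𝓝 (1 : G)) :
    ∀ᶠ x in 𝓝 (1 : G), x ∈ H.convergent →
      ∃ b ∈ H.fixedSubgroup, b ∈ U ∧ ∃ a ∈ H.attracted, a ∈ U ∧ x = b * a := by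
  have hdiv : Tendsto (fun p : G × G => p.1 * p.2⁻¹) (𝓝 1 ×ˢ 𝓝 1) (𝓝 1) := by
    have hc : Continuous fun p : G × G => p.1 * p.2⁻¹ := by fun_prop
    simpa [nhds_prod_eq] using hc.tendsto (1, 1)
  obtain ⟨V, hV, W, hW, hVW⟩ := mem_prod_iff.1 (hdiv.eventually_mem hU)
  obtain ⟨r, hr, hsmall⟩ := exists_forall_velocity_lt_mem hD (inter_mem hU hW)
  have hv : ∀ᶠ x in 𝓝 (1 : G), ‖H.velocity x‖ < r := by
    refine H.continuous_velocity.norm.continuousAt.eventually_lt_const ?_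
    simpa [H.velocity_one] using hr
  filter_upwards [hv, hV] with x hx hxV hxH
  obtain ⟨b, hb, a, ha, rfl⟩ := exists_mul_of_mem_convergent hxH
  rw [H.velocity_mul_of_fixed hb] at hx
  have haUW := hsmall a ha
    (velocity_mem_of_mem_convergent hD (H.attracted_le_convergent ha)) hx
  refine ⟨b, hb, ?_, a, ha, haUW.1, rfl⟩
  simpa using hVW (Set.mk_mem_prod hxV haUW.2)

variable {φ : AutFlow E G} (hcomm : ∀ s t g, H s (φ t g) = φ t (H s g))
  (hφ : ∀ ε > 0, ∀ᶠ t in atTop, ∀ w ∈ contractingSpace D, ‖φ.differential t w‖ ≤ ε * ‖w‖)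
include hcomm hφ

/-- φ_t acts on velocities by its differential, which shrinks them uniformly on the contracted
subspace; a small velocity then forces φ_t(x) to be near 1. -/
theorem eventually_map_attracted_mem (R : ℝ) {W : Set G} (hW : W ∈ 𝓝 (1 : G)) :
    ∀ᶠ t in atTop, ∀ x ∈ H.attracted, ‖H.velocity x‖ ≤ R → φ t x ∈ W := by
  obtain ⟨r, hr, hsmall⟩ := exists_forall_velocity_lt_mem hD hW
  have hε : 0 < r / (|R| + 1) := by positivity
  filter_upwards [hφ _ hε] with t ht x hx hxR
  have hφx := map_mem_attracted hcomm t hx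
  refine hsmall _ hφx
    (velocity_mem_of_mem_convergent hD (H.attracted_le_convergent hφx)) ?_
  rw [H.velocity_map φ (fun s g => hcomm s t g)]
  refine (ht _ (velocity_mem_of_mem_convergent hD (H.attracted_le_convergent hx))).trans_lt ?_
  calc r / (|R| + 1) * ‖H.velocity x‖ ≤ r / (|R| + 1) * |R| := by
        gcongr
        exact hxR.trans (le_abs_self R)
    _ < r / (|R| + 1) * (|R| + 1) := by gcongr; linarith
    _ = r := by field_simp

theorem tendsto_map_attracted {x : G} (hx : x ∈ H.attracted) :
    Tendsto (fun t => φ t x) atTop (𝓝 1) := fun _ hW =>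
  (eventually_map_attracted_mem hD hcomm hφ ‖H.velocity x‖ hW).mono fun _ ht => ht x hx le_rfl

theorem exists_nhds_uniform_contraction :
    ∃ V ∈ 𝓝 (1 : G), ∀ W ∈ 𝓝 (1 : G), ∀ᶠ t in atTop, ∀ p ∈ H.attracted, p ∈ V → φ t p ∈ W := by
  refine ⟨{x | ‖H.velocity x‖ < 1}, ?_, fun W hW => ?_⟩
  · refine H.continuous_velocity.norm.continuousAt.eventually_lt_const ?_
    simp [H.velocity_one]
  · exact (eventually_map_attracted_mem hD hcomm hφ 1 hW).mono
      fun t ht x hx hxV => ht x hx (le_of_lt hxV)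

end Derivation

/-- The connected subgroup of a contracted subspace is attracted to the identity. -/
theorem connectedSubgroup_le_attracted [T2Space G] {H : AutFlow E G} {D : E →L[ℝ] E}
    (hD : H.HasDerivation D) {V : Submodule ℝ E} (hV : V ≤ contractingSpace D) :
    connectedSubgroup V ≤ H.attracted := by
  refine (Subgroup.closure_le _).2 ?_
  rintro g ⟨γ, hγ, hsmooth, hv, rfl⟩
  refine mem_attracted.2 fun U hU => ?_
  obtain ⟨r, hr, hsmall⟩ := exists_forall_oneParameter_mem (E := E) hU
  have hlim := (mem_contractingSpace.1 (hV hv)).norm.eventually_lt_const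
    (u := r) (by simpa using hr)
  have h1 : γ 0 = 1 := by simpa using hγ 0 0
  refine hlim.mono fun t ht => ?_
  -- H_t ∘ γ is again a one-parameter subgroup, with initial velocity exp(tD) v.
  refine hsmall (fun s => H t (γ s)) (fun s u => by rw [hγ, map_mul]) _
    ((H.contMDiff_apply t).continuous.comp hsmooth.continuous)
    (hasDerivAt_oneChart_comp (H.contMDiff_apply t 1) (by simp)
      hsmooth.continuous.continuousAt h1 (hasDerivAt_oneChart_of_mfderiv hsmooth h1)) ?_
  rw [← differential_eq_coordDeriv, hD]
  exact ht

end AutFlow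

end DynamicalSubgroups

/-! ### Chain recurrence on the fixed point group -/

section Recurrence

open Filter NormedSpace

variable {E : Type*} [NormedAddCommGroup E] [NormedSpace ℝ E]

/-- A family of subexponential growth does not destroy the contraction by `exp (t D)`. -/
theorem eventually_norm_apply_exp_smul_le [FiniteDimensional ℝ E] (D : E →L[ℝ] E)
    {B : ℝ → E →L[ℝ] E} (hB : ∀ c > 0, ∃ C, ∀ t, ‖B t‖ ≤ C * Real.exp (c * |t|))
    {ε : ℝ} (hε : 0 < ε) :
    ∀ᶠ t in atTop, ∀ w ∈ contractingSpace D, ‖B t (exp (t • D) w)‖ ≤ ε * ‖w‖ := by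
  obtain ⟨k, hk, M, hM, hdecay⟩ := exists_norm_exp_smul_le D
  -- Growth at half the decay rate k still leaves decay at rate k/2.
  obtain ⟨C, hC⟩ := hB (k / 2) (by positivity)
  have hlim : Tendsto (fun t : ℝ => C * M * Real.exp (-(k / 2) * t)) atTop (𝓝 0) := by
    have h1 : Tendsto (fun t : ℝ => Real.exp (-(k / 2) * t)) atTop (𝓝 0) :=
      Real.tendsto_exp_atBot.comp (tendsto_id.const_mul_atTop_of_neg (by linarith))
    simpa using h1.const_mul (C * M)
  filter_upwards [hlim.eventually_le_const hε, eventually_ge_atTop 0] with t ht ht0 w hw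
  have h1 := hC t
  rw [abs_of_nonneg ht0] at h1
  calc ‖B t (exp (t • D) w)‖ ≤ ‖B t‖ * ‖exp (t • D) w‖ := (B t).le_opNorm _
    _ ≤ (C * Real.exp (k / 2 * t)) * (M * Real.exp (-(k * t)) * ‖w‖) :=
        mul_le_mul h1 (hdecay w hw t ht0) (norm_nonneg _) ((norm_nonneg _).trans h1)
    _ = C * M * Real.exp (-(k / 2) * t) * ‖w‖ := by
        rw [show -(k / 2) * t = k / 2 * t + -(k * t) by ring, Real.exp_add]
        ring
    _ ≤ ε * ‖w‖ := by gcongr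

variable {G : Type*} [TopologicalSpace G] [ChartedSpace E G] [Group G] [LieGroup 𝓘(ℝ, E) ∞ G]

namespace AutFlow

theorem JordanDecomposition.differential_apply {φ : AutFlow E G} (J : φ.JordanDecomposition)
    (t : ℝ) (w : E) :
    φ.differential t w = (exp (t • J.ellDer) * exp (t • J.nilDer)) (exp (t • J.hypDer) w) := by
  rw [mul_apply_eq_comp, ← J.hyp_der, ← J.ell_der, ← J.nil_der,
    ← differential_comp J.nil J.hyp, differential_eq_coordDeriv J.ell,
    ← coordDeriv_comp (Φ := fun g => J.nil t (J.hyp t g)) (J.ell.contMDiff_apply t 1)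
      (((J.nil.contMDiff_apply t).comp (J.hyp.contMDiff_apply t)) 1) (by simp) (by simp),
    differential_eq_coordDeriv φ]
  congr 2
  funext g
  rw [J.eq_comp, ← J.comm_hyp_nil, ← J.comm_hyp_ell]

variable [FiniteDimensional ℝ E] [T2Space G] [IsTopologicalGroup G] [ConnectedSpace G]

/-- If `G` is the product of the groups of the points that converge to a fixed point of `H` in one
time direction and of those that converge to the identity in the other one, and if `φ` commutes
with `H` and contracts whatever `H` contracts, then the chain recurrent points of `φ` are chain
recurrent in the fixed point group of `H`. -/
theorem chainRecurrentIn_fixedSubgroup {φ H : AutFlow E G} {D : E →L[ℝ] E}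
    (hD : H.HasDerivation D) (hcomm : ∀ s t g, H s (φ t g) = φ t (H s g))
    (hφ : ∀ ε > 0, ∀ᶠ t in atTop, ∀ w ∈ contractingSpace D, ‖φ.differential t w‖ ≤ ε * ‖w‖)
    (hφ' : ∀ ε > 0, ∀ᶠ t in atTop, ∀ w ∈ contractingSpace (-D),
      ‖φ.rev.differential t w‖ ≤ ε * ‖w‖)
    (hdec : ∀ x : G, ∃ y ∈ H.rev.convergent, ∃ a ∈ H.attracted, x = y * a)
    (hdec' : ∀ x : G, ∃ y ∈ H.convergent, ∃ a ∈ H.rev.attracted, x = y * a)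
    {a : G} (h : ChainRecurrentIn (fun t => φ t) Set.univ a) :
    ChainRecurrentIn (fun t => φ t) H.fixedSubgroup a := by
  have : LocallyCompactSpace G := Manifold.locallyCompact_of_finiteDimensional 𝓘(ℝ, E)
  have : SigmaCompactSpace G := sigmaCompactSpace_of_connected
  have hcomm' : ∀ s t g, H.rev s (φ t g) = φ t (H.rev s g) := fun s t g => hcomm (-s) t g
  have hclosed := isClosed_convergent hD hdec
  have hclosed' := isClosed_convergent hD.rev (by rwa [rev_rev])
  -- Enlarging A to C makes both factors closed, as the open mapping theorem requires.
  have hprod : ∀ x : G, ∃ y ∈ H.rev.convergent, ∃ z ∈ H.convergent, x = y * z := fun x => by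
    obtain ⟨y, hy, a, ha, e⟩ := hdec x
    exact ⟨y, hy, a, H.attracted_le_convergent ha, e⟩
  have hconv : ChainRecurrentIn (fun t => φ t) H.rev.convergent a := by
    refine ChainRecurrentIn.of_contracting (K := ⊤) (P := H.attracted) le_top
      (fun t x hx => map_mem_convergent hcomm' t hx) (fun g hg hg' => ?_)
      (fun x _ => hdec x) (fun U hU => ?_) (exists_nhds_uniform_contraction hD hcomm hφ)
      (fun p hp => tendsto_map_attracted hD hcomm hφ hp) (by simpa using h)
    · exact eq_one_of_fixed_of_attracted (mem_fixedSubgroup_of_mem_convergent hD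
        (H.attracted_le_convergent hg') hg) hg'
    · have hmul : Tendsto (fun p : G × G => p.1 * p.2) (𝓝 1 ×ˢ 𝓝 1) (𝓝 1) := by
        simpa [nhds_prod_eq] using (continuous_mul (M := G)).tendsto (1, 1)
      obtain ⟨V, hV, W, hW, hVW⟩ := mem_prod_iff.1 (hmul.eventually_mem hU)
      have hfix := eventually_exists_fixed_mul_attracted hD (inter_mem hU hW)
      filter_upwards [eventually_exists_mul_of_isClosed hclosed' hclosed hprod
        (inter_mem hV hfix)] with x hx _
      -- From x = yz with z = bc in G⁰A, regroup as (yb)c: the fixed factor b is absorbed into C'.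
      obtain ⟨y, hy, hyV, z, hz, hzV, rfl⟩ := hx
      obtain ⟨b, hb, hbU, c, hc, hcU, rfl⟩ := hzV.2 hz
      refine ⟨y * b, mul_mem hy ?_, hVW (Set.mk_mem_prod hyV.1 hbU.2), c, hc, hcU.1,
        (mul_assoc _ _ _).symm⟩
      exact H.rev.fixedSubgroup_le_convergent (by rwa [fixedSubgroup_rev])
  have hconv_rev := hconv.reverse φ.map_add φ.map_zero_apply φ.continuous_uncurry
    (fun t x hx => map_mem_convergent hcomm' t hx)
  have hcommrev : ∀ s t g, H.rev s (φ.rev t g) = φ.rev t (H.rev s g) :=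
    fun s t g => hcomm (-s) (-t) g
  have hfixed_rev : ChainRecurrentIn (fun t => φ.rev t) H.fixedSubgroup a := by
    rw [← fixedSubgroup_rev]
    refine ChainRecurrentIn.of_contracting (K := H.rev.convergent) (P := H.rev.attracted)
      H.rev.fixedSubgroup_le_convergent (fun t x hx => map_mem_fixedSubgroup hcommrev t hx)
      (fun g hg hg' => eq_one_of_fixed_of_attracted hg hg')
      (fun x hx => exists_mul_of_mem_convergent hx)
      (fun U hU => eventually_exists_fixed_mul_attracted hD.rev hU)
      (exists_nhds_uniform_contraction hD.rev hcommrev hφ')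
      (fun p hp => tendsto_map_attracted hD.rev hcommrev hφ' hp) hconv_rev
  have hfixed := hfixed_rev.reverse φ.rev.map_add φ.rev.map_zero_apply φ.rev.continuous_uncurry
    (fun t x hx => map_mem_fixedSubgroup (fun s t g => hcomm s (-t) g) t hx)
  simpa [rev_apply, rev] using hfixed

end AutFlow

end Recurrence

end

/-! ### The theorem -/

theorem corollary3p6 {E : Type*} [NormedAddCommGroup E] [NormedSpace ℝ E] [FiniteDimensional ℝ E]
    {G : Type*} [TopologicalSpace G] [ChartedSpace E G] [Group G] [LieGroup 𝓘(ℝ, E) ∞ G]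
    [T2Space G] [ConnectedSpace G] (φ : AutFlow E G) (hφ : φ.Decomposes) :
    chainRecurrentSet (fun t => φ t) = Subtype.val '' chainRecurrentSet φ.restrictCentral := by
  have : IsTopologicalGroup G := topologicalGroup_of_lieGroup 𝓘(ℝ, E) ∞
  ext a
  rw [mem_chainRecurrentSet_iff, mem_image_chainRecurrentSet_iff (φ := fun t => φ t)
    (fun t x => rfl)]
  refine ⟨fun h => ?_, fun h U hU τ hτ => Relation.TransGen.mono
    (fun x y hxy => ⟨trivial, trivial, hxy.2.2⟩) _ _ (h U hU τ hτ)⟩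
  by_cases hJ : Nonempty φ.JordanDecomposition
  · have hH : φ.hyperbolicPart = hJ.some.hyp := dif_pos hJ
    have hDer : φ.hyperbolicDerivation = hJ.some.hypDer := dif_pos hJ
    set J := hJ.some
    have hcentral : φ.central = J.hyp.fixedSubgroup := by
      ext g
      change (∀ t, φ.hyperbolicPart t g = g) ↔ ∀ t, J.hyp t g = g
      rw [hH]
    have hst : φ.stable ≤ J.hyp.attracted := by
      unfold AutFlow.stable
      rw [hDer]
      exact AutFlow.connectedSubgroup_le_attracted J.hyp_der (stableSpace_le_contractingSpace _)
    have hun : φ.unstable ≤ J.hyp.rev.attracted := by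
      unfold AutFlow.unstable
      rw [hDer]
      exact AutFlow.connectedSubgroup_le_attracted J.hyp_der.rev
        (unstableSpace_le_contractingSpace _)
    obtain ⟨h1, h2⟩ := hφ
    rw [hcentral] at h1 h2 ⊢
    have hgrowth : ∀ c > 0, ∃ C, ∀ t : ℝ,
        ‖NormedSpace.exp (t • J.ellDer) * NormedSpace.exp (t • J.nilDer)‖ ≤
          C * Real.exp (c * |t|) :=
      fun c hc => exists_norm_exp_mul_exp_le J.ell_elliptic J.nil_nilpotent hc
    refine AutFlow.chainRecurrentIn_fixedSubgroup J.hyp_der ?_ ?_ ?_ ?_ ?_ h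
    · intro s t g
      have := φ.hyperbolicPart_comm s t g
      rwa [hH] at this
    · intro ε hε
      simp only [J.differential_apply]
      exact eventually_norm_apply_exp_smul_le J.hypDer hgrowth hε
    · intro ε hε
      have := eventually_norm_apply_exp_smul_le (-J.hypDer) (B := fun t =>
        NormedSpace.exp ((-t) • J.ellDer) * NormedSpace.exp ((-t) • J.nilDer))
        (fun c hc => by
          obtain ⟨C, hC⟩ := hgrowth c hc
          exact ⟨C, fun t => by simpa using hC (-t)⟩) hε
      simpa only [AutFlow.differential_rev, J.differential_apply, smul_neg, ← neg_smul] using this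
    · intro x
      obtain ⟨-, ⟨u, hu, b, hb, rfl⟩, s, hs, rfl⟩ := h1.ge (Set.mem_univ x)
      exact ⟨u * b, mul_mem (J.hyp.rev.attracted_le_convergent (hun hu))
        (J.hyp.rev.fixedSubgroup_le_convergent (by rwa [AutFlow.fixedSubgroup_rev])),
        s, hst hs, rfl⟩
    · intro x
      obtain ⟨-, ⟨s, hs, b, hb, rfl⟩, u, hu, rfl⟩ := h2.ge (Set.mem_univ x)
      exact ⟨s * b, mul_mem (J.hyp.attracted_le_convergent (hst hs))
        (J.hyp.fixedSubgroup_le_convergent hb), u, hun hu, rfl⟩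
  -- Without a Jordan decomposition the hyperbolic part is by default the trivial flow, so every
  -- point is central.
  · have hcentral : (φ.central : Set G) = Set.univ := by
      refine Set.eq_univ_of_forall fun g t => ?_
      rw [show φ.hyperbolicPart = AutFlow.trivial from dif_neg hJ]
      rfl
    rwa [hcentral]
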